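/- Let $R$ be an integral domain containing the field of rational numbers $\mathbb{Q}$ which is radically Noetherian, i.e. satisfies the ascending chain condition for radical ideals, and let $m\ge 0$ be an integer. An $R$-algebra is an $R$-module with an $R$-bilinear multiplication (not assumed associative, commutative or unital). Let $C_m=R[x_1,\dots,x_m]$ with the derivations $\partial_i=\partial/\partial x_i$. The left-symmetric Witt algebra $L_m$ over $R$ is the $R$-module of all $f_1\partial_1+\dots+f_m\partial_m$ with $f_i\in C_m$, with the bilinear product determined by $f\partial_i\circ g\partial_j=f\,\partial_i(g)\,\partial_j$; the Witt algebra $W_m$ is the same module with the product $[u,v]=u\circ v-v\circ u$. For an $R$-algebra $A$, $\mathrm{Var}(A)$ denotes the variety generated by $A$, i.e. the class of all $R$-algebras satisfying all identities of $A$. An $R$-algebra $A$ is called equationally Noetherian if for every natural number $n$ the set $A^n$ is a Noetherian topological space in the Zariski topology, i.e. the coarsest topology in which all sets $$Z(S)=\{(a_1,\dots,a_n)\in A^n : f(a_1,\dots,a_n)=0 \text{ for all } f\in S\},\qquad S\subseteq A\sqcup_{\mathfrak M}\mathfrak M\langle x_1,\dots,x_n\rangle,$$ are closed. Here $\mathfrak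 M$ is any variety of $R$-algebras containing $A$, $A\sqcup_{\mathfrak M}\mathfrak M\langle x_1,\dots,x_n\rangle$ is the coproduct in $\mathfrak M$ of $A$ and the free algebra of $\mathfrak M$ on $x_1,\dots,x_n$, and $f(a_1,\dots,a_n)$ is the image of $f$ under the homomorphism to $A$ that is the identity on $A$ and sends each $x_i$ to $a_i$ (the topology does not depend on the choice of $\mathfrak M$). Then: (a) every free algebra over $R$ of the variety $\mathrm{Var}(L_m)$, on any set of free generators, is equationally Noetherian; (b) every free algebra over $R$ of the variety $\mathrm{Var}(W_m)$, on any set of free generators, is equationally Noetherian. -/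

import Mathlib

set_option linter.unusedSectionVars false

universe u v w

/-! ### Algebras over `R`, identities, varieties, free algebras

An `R`-algebra is a (non-unital, not necessarily associative) ring with an `R`-module structure
for which multiplication is bilinear.  A variety of `R`-algebras is the class of all models of a
set of identities, that is, of a set of elements of the absolutely free algebra on the variables
`0, 1, 2, …`. -/

/-- `f = 0` is an identity of the algebra `A`. -/
def IsIdentity (R : Type u) [CommRing R] (A : Type v) [NonUnitalNonAssocRing A] [Module R A]
    [IsScalarTower R A A] [SMulCommClass R A A] (f : FreeNonUnitalNonAssocAlgebra R ℕ) : Prop :=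
  ∀ a : ℕ → A, FreeNonUnitalNonAssocAlgebra.lift R a f = 0

/-- The set of all identities of `A`.  The variety `Var(A)` generated by `A` is the class of models
of this set. -/
def identitiesOf (R : Type u) [CommRing R] (A : Type v) [NonUnitalNonAssocRing A] [Module R A]
    [IsScalarTower R A A] [SMulCommClass R A A] : Set (FreeNonUnitalNonAssocAlgebra R ℕ) :=
  {f | IsIdentity R A f}

/-- `B` belongs to the variety defined by the set of identities `E`. -/
def InVariety (R : Type u) [CommRing R] (E : Set (FreeNonUnitalNonAssocAlgebra R ℕ))
    (B : Type v) [NonUnitalNonAssocRing B] [Module R B]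
    [IsScalarTower R B B] [SMulCommClass R B B] : Prop :=
  ∀ f ∈ E, IsIdentity R B f

/-- `F` is a free algebra, with free generators `ι x` for `x : X`, of the variety defined by `E`. -/
structure IsFreeInVariety (R : Type u) [CommRing R] (E : Set (FreeNonUnitalNonAssocAlgebra R ℕ))
    {X : Type w} {F : Type v} [NonUnitalNonAssocRing F] [Module R F]
    [IsScalarTower R F F] [SMulCommClass R F F] (ι : X → F) : Prop where
  mem : InVariety R E F
  existsUnique_hom : ∀ (B : Type v) [NonUnitalNonAssocRing B] [Module R B]
    [IsScalarTower R B B] [SMulCommClass R B B], InVariety R E B →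
    ∀ b : X → B, ∃! φ : F →ₙₐ[R] B, ∀ x, φ (ι x) = b x

/-! ### The coproduct of `A` with a free algebra of rank `n` in a variety -/

section Coproduct

variable (R : Type u) [CommRing R] (E : Set (FreeNonUnitalNonAssocAlgebra R ℕ))
  (A : Type v) [NonUnitalNonAssocRing A] [Module R A] [IsScalarTower R A A] [SMulCommClass R A A]
  (n : ℕ)

/-- The absolutely free algebra on the elements of `A` and `n` further variables. -/
abbrev PreCoproduct : Type (max u v) := FreeNonUnitalNonAssocAlgebra R (A ⊕ Fin n)

/-- The symbol of the element `a` of `A`. -/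
noncomputable abbrev preConst (a : A) : PreCoproduct R A n :=
  FreeNonUnitalNonAssocAlgebra.of R (Sum.inl a)

/-- The `i`-th variable. -/
noncomputable abbrev preVar (i : Fin n) : PreCoproduct R A n :=
  FreeNonUnitalNonAssocAlgebra.of R (Sum.inr i)

/-- `J` is a two-sided ideal of the algebra `PreCoproduct R A n`, it contains all values of the
identities in `E`, and modulo `J` the map `preConst` is a homomorphism of algebras. -/
structure IsCoproductIdeal (J : Submodule R (PreCoproduct R A n)) : Prop where
  mul_right : ∀ p q, p ∈ J → p * q ∈ J
  mul_left : ∀ p q, q ∈ J → p * q ∈ J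
  identity : ∀ f ∈ E, ∀ p : ℕ → PreCoproduct R A n, FreeNonUnitalNonAssocAlgebra.lift R p f ∈ J
  add : ∀ a b : A, preConst R A n (a + b) - (preConst R A n a + preConst R A n b) ∈ J
  smul : ∀ (r : R) (a : A), preConst R A n (r • a) - r • preConst R A n a ∈ J
  mul : ∀ a b : A, preConst R A n (a * b) - preConst R A n a * preConst R A n b ∈ J

/-- The smallest ideal as in `IsCoproductIdeal`. -/
noncomputable def coproductIdeal : Submodule R (PreCoproduct R A n) :=
  sInf {J | IsCoproductIdeal R E A n J}

theorem coproductIdeal_spec : IsCoproductIdeal R E A n (coproductIdeal R E A n) where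
  mul_right p q hp := by
    simp only [coproductIdeal, Submodule.mem_sInf] at hp ⊢
    exact fun J hJ => hJ.mul_right p q (hp J hJ)
  mul_left p q hq := by
    simp only [coproductIdeal, Submodule.mem_sInf] at hq ⊢
    exact fun J hJ => hJ.mul_left p q (hq J hJ)
  identity f hf p := by
    simp only [coproductIdeal, Submodule.mem_sInf]
    exact fun J hJ => hJ.identity f hf p
  add a b := by
    simp only [coproductIdeal, Submodule.mem_sInf]
    exact fun J hJ => hJ.add a b
  smul r a := by
    simp only [coproductIdeal, Submodule.mem_sInf]
    exact fun J hJ => hJ.smul r a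
  mul a b := by
    simp only [coproductIdeal, Submodule.mem_sInf]
    exact fun J hJ => hJ.mul a b

/-- The coproduct `A ⊔ 𝔐⟨x₁, …, xₙ⟩` in the variety `𝔐` defined by `E` (see
`Coproduct.existsUnique_hom` for its universal property). -/
def Coproduct : Type (max u v) := PreCoproduct R A n ⧸ coproductIdeal R E A n

namespace Coproduct

noncomputable instance : AddCommGroup (Coproduct R E A n) :=
  inferInstanceAs (AddCommGroup (PreCoproduct R A n ⧸ coproductIdeal R E A n))

noncomputable instance : Module R (Coproduct R E A n) :=
  inferInstanceAs (Module R (PreCoproduct R A n ⧸ coproductIdeal R E A n))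

/-- The quotient map. -/
noncomputable def mk : PreCoproduct R A n →ₗ[R] Coproduct R E A n :=
  (coproductIdeal R E A n).mkQ

theorem mk_surjective : Function.Surjective (mk R E A n) :=
  Submodule.mkQ_surjective _

theorem mk_eq_mk {p q : PreCoproduct R A n} :
    mk R E A n p = mk R E A n q ↔ p - q ∈ coproductIdeal R E A n :=
  Submodule.Quotient.eq _

/-- The multiplication induced on the quotient. -/
noncomputable def mulMap :
    Coproduct R E A n →ₗ[R] Coproduct R E A n →ₗ[R] Coproduct R E A n :=
  Submodule.liftQ (coproductIdeal R E A n)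
    (LinearMap.mk₂ R
      (fun p (y : Coproduct R E A n) => Submodule.mapQ (coproductIdeal R E A n)
        (coproductIdeal R E A n) (LinearMap.mul R (PreCoproduct R A n) p)
        (fun q hq => (coproductIdeal_spec R E A n).mul_left p q hq) y)
      (fun p p' y => by
        obtain ⟨q, rfl⟩ := mk_surjective R E A n y
        change mk R E A n ((p + p') * q) = mk R E A n (p * q) + mk R E A n (p' * q)
        rw [add_mul, map_add])
      (fun r p y => by
        obtain ⟨q, rfl⟩ := mk_surjective R E A n y
        change mk R E A n ((r • p) * q) = r • mk R E A n (p * q)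
        rw [smul_mul_assoc, map_smul])
      (fun p y y' => map_add _ y y')
      (fun r p y => map_smul _ r y))
    (fun p hp => by
      rw [LinearMap.mem_ker]
      ext y
      obtain ⟨q, rfl⟩ := mk_surjective R E A n y
      change mk R E A n (p * q) = 0
      rw [← map_zero (mk R E A n), mk_eq_mk, sub_zero]
      exact (coproductIdeal_spec R E A n).mul_right p q hp)

noncomputable instance : NonUnitalNonAssocRing (Coproduct R E A n) where
  mul x y := mulMap R E A n x y
  left_distrib x y z := map_add (mulMap R E A n x) y z
  right_distrib x y z := by
    change mulMap R E A n (x + y) z = mulMap R E A n x z + mulMap R E A n y z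
    rw [map_add, LinearMap.add_apply]
  zero_mul x := by
    change mulMap R E A n 0 x = 0
    rw [map_zero, LinearMap.zero_apply]
  mul_zero x := map_zero (mulMap R E A n x)

instance : IsScalarTower R (Coproduct R E A n) (Coproduct R E A n) where
  smul_assoc r x y := by
    change mulMap R E A n (r • x) y = r • mulMap R E A n x y
    rw [map_smul, LinearMap.smul_apply]

instance : SMulCommClass R (Coproduct R E A n) (Coproduct R E A n) where
  smul_comm r x y := (map_smul (mulMap R E A n x) r y).symm

theorem mk_mul (p q : PreCoproduct R A n) :
    mk R E A n (p * q) = mk R E A n p * mk R E A n q := rfl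

/-- The quotient map as a homomorphism of algebras. -/
noncomputable def mkHom : PreCoproduct R A n →ₙₐ[R] Coproduct R E A n where
  toFun := mk R E A n
  map_smul' r p := map_smul _ r p
  map_zero' := map_zero _
  map_add' := map_add _
  map_mul' := mk_mul R E A n

/-- The canonical homomorphism from `A`. -/
noncomputable def const : A →ₙₐ[R] Coproduct R E A n where
  toFun a := mk R E A n (preConst R A n a)
  map_smul' r a := by
    change mk R E A n _ = r • mk R E A n _
    rw [← map_smul, mk_eq_mk]
    exact (coproductIdeal_spec R E A n).smul r a
  map_zero' := by
    have h := (coproductIdeal_spec R E A n).smul 0 0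
    rwa [zero_smul, zero_smul, ← mk_eq_mk, map_zero] at h
  map_add' a b := by
    rw [← map_add, mk_eq_mk]
    exact (coproductIdeal_spec R E A n).add a b
  map_mul' a b := by
    rw [← mk_mul, mk_eq_mk]
    exact (coproductIdeal_spec R E A n).mul a b

/-- The variable `xᵢ`, a free generator of `𝔐⟨x₁, …, xₙ⟩`. -/
noncomputable def var (i : Fin n) : Coproduct R E A n := mk R E A n (preVar R A n i)

/-- The coproduct lies in the variety. -/
theorem inVariety : InVariety R E (Coproduct R E A n) := by
  intro f hf a
  choose p hp using fun i => mk_surjective R E A n (a i)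
  have h : FreeNonUnitalNonAssocAlgebra.lift R a =
      (mkHom R E A n).comp (FreeNonUnitalNonAssocAlgebra.lift R p) := by
    refine FreeNonUnitalNonAssocAlgebra.hom_ext R fun i => ?_
    simp only [NonUnitalAlgHom.comp_apply, FreeNonUnitalNonAssocAlgebra.lift_of_apply]
    exact (hp i).symm
  rw [h, NonUnitalAlgHom.comp_apply]
  change mk R E A n _ = 0
  rw [← map_zero (mk R E A n), mk_eq_mk, sub_zero]
  exact (coproductIdeal_spec R E A n).identity f hf p

variable {R E A n}

variable {C : Type w} [NonUnitalNonAssocRing C] [Module R C]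
  [IsScalarTower R C C] [SMulCommClass R C C]

theorem coproductIdeal_le_ker (hC : InVariety R E C) (φ : A →ₙₐ[R] C) (c : Fin n → C)
    (p : PreCoproduct R A n) (hp : p ∈ coproductIdeal R E A n) :
    FreeNonUnitalNonAssocAlgebra.lift R (Sum.elim φ c) p = 0 := by
  let Φ : PreCoproduct R A n →ₙₐ[R] C := FreeNonUnitalNonAssocAlgebra.lift R (Sum.elim φ c)
  have hΦ : ∀ a, Φ (preConst R A n a) = φ a := fun a => by
    simp [Φ, preConst, FreeNonUnitalNonAssocAlgebra.lift_of_apply]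
  let K : Submodule R (PreCoproduct R A n) :=
    LinearMap.ker (Φ : PreCoproduct R A n →ₗ[R] C)
  have memK : ∀ q, q ∈ K ↔ Φ q = 0 := fun q => Iff.rfl
  have hK : IsCoproductIdeal R E A n K :=
    { mul_right := fun p q hp => by
        rw [memK] at hp ⊢
        rw [map_mul, hp, zero_mul]
      mul_left := fun p q hq => by
        rw [memK] at hq ⊢
        rw [map_mul, hq, mul_zero]
      identity := fun f hf p => by
        rw [memK]
        have h : Φ.comp (FreeNonUnitalNonAssocAlgebra.lift R p) =
            FreeNonUnitalNonAssocAlgebra.lift R (fun i => Φ (p i)) := by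
          refine FreeNonUnitalNonAssocAlgebra.hom_ext R fun i => ?_
          simp only [NonUnitalAlgHom.comp_apply, FreeNonUnitalNonAssocAlgebra.lift_of_apply]
        rw [← NonUnitalAlgHom.comp_apply, h]
        exact hC f hf _
      add := fun a b => by rw [memK, map_sub, map_add, hΦ, hΦ, hΦ, map_add, sub_self]
      smul := fun r a => by rw [memK, map_sub, map_smul, hΦ, hΦ, map_smul, sub_self]
      mul := fun a b => by rw [memK, map_sub, map_mul, hΦ, hΦ, hΦ, map_mul, sub_self] }
  have h : coproductIdeal R E A n ≤ K := sInf_le hK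
  exact (memK p).1 (h hp)

/-- The homomorphism from the coproduct to an algebra `C` of the variety that is `φ` on `A` and
sends `xᵢ` to `c i`. -/
noncomputable def lift (hC : InVariety R E C) (φ : A →ₙₐ[R] C) (c : Fin n → C) :
    Coproduct R E A n →ₙₐ[R] C :=
  let L : Coproduct R E A n →ₗ[R] C := Submodule.liftQ (coproductIdeal R E A n)
    (FreeNonUnitalNonAssocAlgebra.lift R (Sum.elim φ c) : PreCoproduct R A n →ₗ[R] C)
    (coproductIdeal_le_ker hC φ c)
  { toFun := L
    map_smul' := fun r x => map_smul L r x
    map_zero' := map_zero L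
    map_add' := map_add L
    map_mul' := fun x y => by
      obtain ⟨p, rfl⟩ := mk_surjective R E A n x
      obtain ⟨q, rfl⟩ := mk_surjective R E A n y
      exact map_mul (FreeNonUnitalNonAssocAlgebra.lift R (Sum.elim φ c)) p q }

theorem lift_mk (hC : InVariety R E C) (φ : A →ₙₐ[R] C) (c : Fin n → C)
    (p : PreCoproduct R A n) :
    lift hC φ c (mk R E A n p) = FreeNonUnitalNonAssocAlgebra.lift R (Sum.elim φ c) p := rfl

/-- The universal property of the coproduct of `A` and the free algebra on `x₁, …, xₙ`. -/
theorem existsUnique_hom (hC : InVariety R E C) (φ : A →ₙₐ[R] C) (c : Fin n → C) :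
    ∃! Φ : Coproduct R E A n →ₙₐ[R] C,
      (∀ a, Φ (const R E A n a) = φ a) ∧ ∀ i, Φ (var R E A n i) = c i := by
  refine ⟨lift hC φ c, ⟨fun a => ?_, fun i => ?_⟩, fun Ψ hΨ => ?_⟩
  · change lift hC φ c (mk R E A n (preConst R A n a)) = φ a
    rw [lift_mk, FreeNonUnitalNonAssocAlgebra.lift_of_apply, Sum.elim_inl]
  · change lift hC φ c (mk R E A n (preVar R A n i)) = c i
    rw [lift_mk, FreeNonUnitalNonAssocAlgebra.lift_of_apply, Sum.elim_inr]
  · have h : Ψ.comp (mkHom R E A n) = FreeNonUnitalNonAssocAlgebra.lift R (Sum.elim φ c) := by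
      refine FreeNonUnitalNonAssocAlgebra.hom_ext R fun s => ?_
      rw [NonUnitalAlgHom.comp_apply, FreeNonUnitalNonAssocAlgebra.lift_of_apply]
      cases s with
      | inl a => exact hΨ.1 a
      | inr i => exact hΨ.2 i
    ext x
    obtain ⟨p, rfl⟩ := mk_surjective R E A n x
    rw [lift_mk, ← h]
    rfl

end Coproduct

/-! ### Equations and the Zariski topology -/

variable {R E A n}

/-- The value `f(a₁, …, aₙ)` in `A` of an element `f` of `A ⊔ 𝔐⟨x₁, …, xₙ⟩`: its image under the
homomorphism that is the identity on `A` and sends `xᵢ` to `aᵢ`. -/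
noncomputable def evalAt (hA : InVariety R E A) (a : Fin n → A) (f : Coproduct R E A n) : A :=
  Coproduct.lift hA (NonUnitalAlgHom.id R A) a f

/-- The set `Z(S)` of all zeroes of `S` in `Aⁿ`. -/
def zeroSet (hA : InVariety R E A) (S : Set (Coproduct R E A n)) : Set (Fin n → A) :=
  {a | ∀ f ∈ S, evalAt hA a f = 0}

/-- The Zariski topology on `Aⁿ`: the coarsest topology in which every `Z(S)` is closed. -/
@[reducible]
def zariskiTopology (hA : InVariety R E A) (n : ℕ) : TopologicalSpace (Fin n → A) :=
  TopologicalSpace.generateFrom {U | ∃ S : Set (Coproduct R E A n), U = (zeroSet hA S)ᶜ}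

end Coproduct

/-- `A` is equationally Noetherian: whatever variety `𝔐` (given by identities `E`) containing `A`
is used to form the equations, every `Aⁿ` is a Noetherian space in the Zariski topology. -/
def EquationallyNoetherian (R : Type u) [CommRing R] (A : Type v) [NonUnitalNonAssocRing A]
    [Module R A] [IsScalarTower R A A] [SMulCommClass R A A] : Prop :=
  ∀ (E : Set (FreeNonUnitalNonAssocAlgebra R ℕ)) (hA : InVariety R E A) (n : ℕ),
    @TopologicalSpace.NoetherianSpace (Fin n → A) (zariskiTopology hA n)

/-! ### Witt algebras -/

/-- A differential `R`-algebra with the basic set of commuting derivations `δ 0, …, δ (m - 1)`. -/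
class DeltaAlgebra (R : Type u) (m : ℕ) (A : Type v) [CommRing R] [CommRing A] [Algebra R A] where
  δ : Fin m → Derivation R A A
  δ_comm : ∀ (i j : Fin m) (a : A), δ i (δ j a) = δ j (δ i a)

/-- The polynomial algebra `C_m = R[x₁, …, x_m]` with the derivations `∂/∂xᵢ`. -/
noncomputable instance (R : Type u) [CommRing R] (m : ℕ) :
    DeltaAlgebra R m (MvPolynomial (Fin m) R) where
  δ i := MvPolynomial.pderiv i
  δ_comm i j a := by
    have h : ⁅(MvPolynomial.pderiv i : Derivation R (MvPolynomial (Fin m) R) (MvPolynomial (Fin m) R)),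
        (MvPolynomial.pderiv j : Derivation R (MvPolynomial (Fin m) R)
          (MvPolynomial (Fin m) R))⁆ = 0 := by
      refine MvPolynomial.derivation_ext fun k => ?_
      rw [Derivation.commutator_apply]
      simp [MvPolynomial.pderiv_X, Pi.single_apply, apply_ite]
    have h' := congrArg (fun D => D a) h
    simp only [Derivation.commutator_apply, Derivation.coe_zero, Pi.zero_apply] at h'
    exact sub_eq_zero.1 h'

/-- The underlying space of `L(A)`: `f` stands for `f₁ δ₁ + ⋯ + f_m δ_m`. -/
def LeftSymmetricWitt (_R : Type u) (m : ℕ) (A : Type v) : Type v := Fin m → A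

namespace LeftSymmetricWitt

variable (R : Type u) (m : ℕ) (A : Type v) [CommRing R] [CommRing A] [Algebra R A]

instance : AddCommGroup (LeftSymmetricWitt R m A) := inferInstanceAs (AddCommGroup (Fin m → A))

instance : Module R (LeftSymmetricWitt R m A) := inferInstanceAs (Module R (Fin m → A))

variable [DeltaAlgebra R m A]

/-- The bilinear product with `f δᵢ ∘ g δⱼ = f δᵢ(g) δⱼ`. -/
instance : Mul (LeftSymmetricWitt R m A) where
  mul f g := fun j => ∑ i, f i * DeltaAlgebra.δ (R := R) i (g j)

variable {R m A}

theorem add_apply (f g : LeftSymmetricWitt R m A) (j : Fin m) : (f + g) j = f j + g j := rfl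

theorem sub_apply (f g : LeftSymmetricWitt R m A) (j : Fin m) : (f - g) j = f j - g j := rfl

theorem zero_apply (j : Fin m) : (0 : LeftSymmetricWitt R m A) j = 0 := rfl

theorem smul_apply (r : R) (f : LeftSymmetricWitt R m A) (j : Fin m) : (r • f) j = r • f j := rfl

theorem mul_apply (f g : LeftSymmetricWitt R m A) (j : Fin m) :
    (f * g) j = ∑ i, f i * DeltaAlgebra.δ (R := R) i (g j) := rfl

instance : NonUnitalNonAssocRing (LeftSymmetricWitt R m A) where
  left_distrib f g h := by
    funext j
    simp only [mul_apply, add_apply, map_add, mul_add, Finset.sum_add_distrib]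
  right_distrib f g h := by
    funext j
    simp only [mul_apply, add_apply, add_mul, Finset.sum_add_distrib]
  zero_mul f := by
    funext j
    simp only [mul_apply, zero_apply, zero_mul, Finset.sum_const_zero]
  mul_zero f := by
    funext j
    simp only [mul_apply, zero_apply, map_zero, mul_zero, Finset.sum_const_zero]

/-- `L(A)` is left-symmetric. -/
instance : LeftPreLieRing (LeftSymmetricWitt R m A) where
  assoc_symm' f g h := by
    have key : ∀ f g : LeftSymmetricWitt R m A, ∀ j, (associator f g h) j =
        - ∑ k, ∑ i, f k * (g i *
          DeltaAlgebra.δ (R := R) k (DeltaAlgebra.δ (R := R) i (h j))) := by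
      intro f g j
      rw [associator_apply, sub_apply, mul_apply, mul_apply]
      simp only [mul_apply, map_sum, Derivation.leibniz, smul_eq_mul, Finset.mul_sum,
        Finset.sum_mul, mul_add, Finset.sum_add_distrib]
      have h1 : ∑ x, ∑ i, f i * DeltaAlgebra.δ (R := R) i (g x) * DeltaAlgebra.δ (R := R) x (h j)
          = ∑ i, ∑ x, f i * (DeltaAlgebra.δ (R := R) x (h j) * DeltaAlgebra.δ (R := R) i (g x)) := by
        rw [Finset.sum_comm]
        exact Finset.sum_congr rfl fun i _ => Finset.sum_congr rfl fun x _ => by ring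
      rw [h1]
      ring
    funext j
    rw [key, key, Finset.sum_comm]
    congr 1
    refine Finset.sum_congr rfl fun i _ => Finset.sum_congr rfl fun k _ => ?_
    rw [DeltaAlgebra.δ_comm k i]
    ring

instance : LeftPreLieAlgebra R (LeftSymmetricWitt R m A) where
  smul_assoc r f g := by
    funext j
    simp only [smul_eq_mul, mul_apply, smul_apply, smul_mul_assoc, Finset.smul_sum]
  smul_comm r f g := by
    funext j
    simp only [smul_eq_mul, mul_apply, smul_apply, Finset.smul_sum, Derivation.map_smul,
      mul_smul_comm]

end LeftSymmetricWitt

/-- The left-symmetric Witt algebra `L_m = L(C_m)` over `R`. -/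
abbrev WittL (R : Type u) [CommRing R] (m : ℕ) : Type u :=
  LeftSymmetricWitt R m (MvPolynomial (Fin m) R)

/-- The Witt algebra `W_m = W(C_m)` over `R`: the space of `L_m` with the commutator
`[f, g] = f ∘ g - g ∘ f` as its multiplication. -/
abbrev WittW (R : Type u) [CommRing R] (m : ℕ) : Type u := CommutatorRing (WittL R m)

/-! ### Radically Noetherian rings -/

/-- The ascending chain condition for radically closed ideals (`R` carries zero derivations, so
that all its ideals are differential ideals). -/
def RadicallyNoetherian (R : Type u) [CommRing R] : Prop :=
  WellFoundedGT {I : Ideal R // I.IsRadical}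

/-! Both products have the form f ∘ g − s (g ∘ f), with s = 0 for L and s = 1 for W, so
`DeformedWitt` treats the two parts at once.

The free algebra embeds in the algebra over a ring of differential polynomials, each free generator
going to a vector of m independent differential indeterminates. The target lies in the variety
because a differential polynomial vanishing at all points of R[x₁, …, x_m] is zero
(`DiffPoly.eq_zero_of_forall_eval_eq_zero`). The map is injective because a relation between generic
vectors specializes to every choice of elements over C_m, hence is an identity.

Componentwise, an equation in n unknowns becomes m differential polynomial equations in nm unknowns,
the constants supplying coefficients in a set of parameters. It remains to see that such a system is
equivalent to a finite subsystem (`DiffPoly.exists_finset_forall_eval`), a form of the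
Ritt–Raudenbush basis theorem. If no finite subsystem suffices, an ultrafilter limit of the
counterexamples defines a prime differential ideal P containing the whole system. By
`DiffPoly.exists_characteristic_set`, P is controlled by a finite set A ⊆ P and one H ∉ P. Some
counterexample kills A but not H, hence satisfies the whole system, a contradiction. Points are
injective on the parameters, so P contains no nonzero polynomial in the parameters alone, and the
coefficients behave as in a field. -/

/-! ### Differential polynomials -/

/-- The ring of differential polynomials over `R` in the indeterminates `V`, with `m` commuting
derivations that vanish on `R`; the variable `(y, α)` is the derivative of `y` of order `α`. -/
abbrev DiffPoly (R : Type u) [CommRing R] (m : ℕ) (V : Type v) : Type (max u v) :=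
  MvPolynomial (V × (Fin m → ℕ)) R

namespace DiffPoly

open MvPolynomial

variable {R : Type u} [CommRing R] {m : ℕ} {V : Type v}

/-- The derivative of a variable. -/
def shift (j : Fin m) (t : V × (Fin m → ℕ)) : V × (Fin m → ℕ) := (t.1, t.2 + Pi.single j 1)

noncomputable instance : DeltaAlgebra R m (DiffPoly R m V) where
  δ j := mkDerivation R fun t => X (shift j t)
  δ_comm i j a := by
    have h : ⁅mkDerivation R fun t : V × (Fin m → ℕ) => (X (shift i t) : DiffPoly R m V),
        mkDerivation R fun t : V × (Fin m → ℕ) => (X (shift j t) : DiffPoly R m V)⁆ = 0 := by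
      refine derivation_ext fun t => ?_
      rw [Derivation.commutator_apply]
      simp [mkDerivation_X, shift, add_right_comm]
    have h' := congrArg (fun D => D a) h
    simp only [Derivation.commutator_apply, Derivation.coe_zero, Pi.zero_apply] at h'
    exact sub_eq_zero.1 h'

theorem δ_X (j : Fin m) (t : V × (Fin m → ℕ)) :
    DeltaAlgebra.δ (R := R) j (X t : DiffPoly R m V) = X (shift j t) :=
  mkDerivation_X _ _ _

end DiffPoly

/-- An ideal is differential if it is closed under the derivations. -/
def Ideal.IsDifferential (R : Type u) (m : ℕ) {B : Type v} [CommRing R] [CommRing B] [Algebra R B]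
    [DeltaAlgebra R m B] (P : Ideal B) : Prop :=
  ∀ (j : Fin m), ∀ p ∈ P, DeltaAlgebra.δ (R := R) j p ∈ P

/-! ### Polynomials in one variable -/

namespace Polynomial

/-- Pseudo-division: since f need not be monic, each cancellation of the top term of g costs one
factor of the leading coefficient of f. -/
theorem exists_leadingCoeff_pow_mul_eq {A : Type*} [CommRing A] [IsDomain A] {f : A[X]}
    (hf : f ≠ 0) (g : A[X]) :
    ∃ (N : ℕ) (a r : A[X]), C (f.leadingCoeff ^ N) * g = a * f + r ∧ r.degree < f.degree := by
  induction hk : g.natDegree using Nat.strong_induction_on generalizing g with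
  | _ k ih =>
    by_cases hlt : g.degree < f.degree
    · exact ⟨0, 0, g, by simp, hlt⟩
    push Not at hlt
    -- The induction is on `natDegree`, which cannot drop below 0. For constant g, f is constant too
    -- and g · f is an exact multiple, with remainder 0.
    by_cases hk0 : g.natDegree = 0
    · have hf0 : f.natDegree = 0 := Nat.le_zero.1 (hk0 ▸ natDegree_le_natDegree hlt)
      refine ⟨1, g, 0, ?_, by simpa [bot_lt_iff_ne_bot] using hf⟩
      rw [eq_C_of_natDegree_eq_zero hf0]
      simp [mul_comm]
    have hfc : f.leadingCoeff ≠ 0 := leadingCoeff_ne_zero.2 hf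
    have hg : g ≠ 0 := by rintro rfl; simp at hk0
    have hgc : g.leadingCoeff ≠ 0 := leadingCoeff_ne_zero.2 hg
    set g' := C f.leadingCoeff * g - C g.leadingCoeff * X ^ (g.natDegree - f.natDegree) * f with hg'
    have hdeg : g'.degree < (C f.leadingCoeff * g).degree := by
      refine degree_sub_lt_left ?_ (mul_ne_zero (C_ne_zero.2 hfc) hg) ?_
      · rw [degree_C_mul hfc, degree_mul, degree_C_mul_X_pow _ hgc, degree_eq_natDegree hf,
          degree_eq_natDegree hg]
        have := natDegree_le_natDegree hlt
        norm_cast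
        omega
      · rw [leadingCoeff_mul, leadingCoeff_mul, leadingCoeff_C, leadingCoeff_mul_X_pow,
          leadingCoeff_C, mul_comm]
    rw [degree_C_mul hfc] at hdeg
    have hnat : g'.natDegree < k := by
      by_cases h0 : g' = 0
      · rw [h0, natDegree_zero]; omega
      · exact hk ▸ natDegree_lt_natDegree h0 hdeg
    obtain ⟨N, a, r, h, hr⟩ := ih g'.natDegree hnat g' rfl
    refine ⟨N + 1, a + C (f.leadingCoeff ^ N) * (C g.leadingCoeff *
      X ^ (g.natDegree - f.natDegree)), r, ?_, hr⟩
    rw [add_mul, add_right_comm, ← h, hg', pow_succ, C_mul]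
    ring

variable {R B : Type*} [CommRing R] [CommRing B] [Algebra R B] {S : Subalgebra R B}

theorem aeval_mem_of_coeff_mem {Q : Ideal B} (x : B) {g : S[X]}
    (h : ∀ k, (g.coeff k : B) ∈ Q) : aeval x g ∈ Q := by
  rw [aeval_eq_sum_range]
  exact Ideal.sum_mem _ fun k _ => Q.mul_mem_right _ (h k)

/-- Once the leading coefficient is in P, removing the leading term leaves a polynomial still
vanishing modulo P, of no larger degree and with fewer terms, so the hypothesis applies again. -/
theorem coeff_mem_of_leadingCoeff_mem {P : Ideal B} {x : B} {d : ℕ}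
    (h : ∀ g : S[X], aeval x g ∈ P → g.natDegree ≤ d → (g.leadingCoeff : B) ∈ P)
    (g : S[X]) (hg : aeval x g ∈ P) (hd : g.natDegree ≤ d) (k : ℕ) : (g.coeff k : B) ∈ P := by
  induction hn : g.support.card using Nat.strong_induction_on generalizing g with
  | _ n ih =>
    by_cases hg0 : g = 0
    · simp [hg0]
    have hlc := h g hg hd
    have heq := g.eraseLead_add_C_mul_X_pow
    have h1 : aeval x g.eraseLead ∈ P := by
      have : aeval x g.eraseLead = aeval x g - (g.leadingCoeff : B) * x ^ g.natDegree := by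
        conv_rhs => rw [← heq]
        simp only [map_add, map_mul, aeval_C, map_pow, aeval_X]
        rw [heq]
        simp
      rw [this]
      exact P.sub_mem hg (P.mul_mem_right _ hlc)
    have h2 := ih _ (hn ▸ eraseLead_support_card_lt hg0) g.eraseLead h1
      ((eraseLead_natDegree_le _).trans (by omega)) rfl
    by_cases hkd : k = g.natDegree
    · subst hkd; exact hlc
    · rwa [eraseLead_coeff_of_ne _ hkd] at h2

end Polynomial

/-! ### Characteristic sets of prime differential ideals -/

theorem Pi.nat_induction {ι : Type*} [Fintype ι] [DecidableEq ι] {p : (ι → ℕ) → Prop} (h0 : p 0)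
    (hs : ∀ γ j, p γ → p (γ + Pi.single j 1)) (γ : ι → ℕ) : p γ := by
  induction hk : ∑ i, γ i generalizing γ with
  | zero =>
    have : γ = 0 := by
      funext i
      exact (Finset.sum_eq_zero_iff.1 hk) i (Finset.mem_univ i)
    exact this ▸ h0
  | succ k ih =>
    obtain ⟨j, hj⟩ : ∃ j, γ j ≠ 0 := by
      by_contra! h
      simp [h] at hk
    have hle : Pi.single j 1 ≤ γ := by
      intro i
      by_cases hi : i = j
      · subst hi; simpa using Nat.one_le_iff_ne_zero.2 hj
      · simp [hi]
    have heq : γ = (γ - Pi.single j 1) + Pi.single j 1 := (tsub_add_cancel_of_le hle).symm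
    rw [heq]
    refine hs _ _ (ih _ ?_)
    rw [heq] at hk
    simp only [Pi.add_apply, Finset.sum_add_distrib, Finset.sum_pi_single', Finset.mem_univ,
      if_true] at hk
    simpa using hk

/-- Dickson's lemma: the minimal elements form an antichain, which is finite in a well-quasi-order,
and well-foundedness puts one below every element. -/
theorem Set.exists_finite_subset_forall_exists_le {α : Type*} [PartialOrder α]
    [WellQuasiOrderedLE α] (s : Set α) :
    ∃ t : Set α, t.Finite ∧ t ⊆ s ∧ ∀ b ∈ s, ∃ a ∈ t, a ≤ b := by
  refine ⟨{a | Minimal (· ∈ s) a}, ?_, fun a ha => ha.prop, fun b hb => ?_⟩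
  · exact WellQuasiOrderedLE.finite_of_isAntichain (setOfPred_minimal_antichain _)
  · obtain ⟨a, hab, ha⟩ := exists_minimal_le_of_wellFoundedLT (· ∈ s) b hb
    exact ⟨a, ha, hab⟩

namespace DiffPoly

open MvPolynomial

/-! ### Rankings of derivatives and differentiation by rank. -/

section Ranking

variable {m n : ℕ}

/-- A ranking of the derivatives of `n` indeterminates. -/
def rank (t : Fin n × (Fin m → ℕ)) : Lex (Fin m → ℕ) ×ₗ Fin n := toLex (toLex t.2, t.1)

theorem rank_injective : Function.Injective (rank (m := m) (n := n)) := by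
  rintro ⟨z, α⟩ ⟨z', α'⟩ h
  have h' : ((toLex α, z) : Lex (Fin m → ℕ) × Fin n) = (toLex α', z') := toLex.injective h
  simp only [Prod.mk.injEq, EmbeddingLike.apply_eq_iff_eq] at h'
  rw [h'.1, h'.2]

/-- Together with `rank_shift_lt_rank_shift` this is the defining property of a ranking; it holds
because multi-indices are compared first, lexicographically, and indeterminates only to break ties.
-/
theorem rank_lt_rank_shift (j : Fin m) (t : Fin n × (Fin m → ℕ)) : rank t < rank (shift j t) := by
  refine Prod.Lex.toLex_lt_toLex.2 (Or.inl (Pi.toLex_strictMono ?_))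
  refine lt_of_le_of_ne (fun i => Nat.le_add_right _ _) fun h => ?_
  have := congrFun h j
  simp [shift] at this

theorem rank_shift_lt_rank_shift (j : Fin m) {t u : Fin n × (Fin m → ℕ)} (h : rank t < rank u) :
    rank (shift j t) < rank (shift j u) := by
  rcases Prod.Lex.toLex_lt_toLex.1 h with h | ⟨h, h'⟩
  · refine Prod.Lex.toLex_lt_toLex.2 (Or.inl ?_)
    exact add_lt_add_left h (toLex (Pi.single j 1))
  · refine Prod.Lex.toLex_lt_toLex.2 (Or.inr ⟨?_, h'⟩)
    exact congrArg (· + toLex (Pi.single j 1)) h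

theorem wellFounded_rank : WellFounded fun t u : Fin n × (Fin m → ℕ) => rank t < rank u :=
  InvImage.wf rank wellFounded_lt

end Ranking

variable {R : Type u} [CommRing R] {m n : ℕ} {Y : Type v}

/-- The variables that are derivatives of parameters in `Y` or belong to `s`. -/
def varsIn (Y : Type v) (s : Set (Fin n × (Fin m → ℕ))) : Set ((Y ⊕ Fin n) × (Fin m → ℕ)) :=
  {t | ∀ z, t.1 = Sum.inr z → (z, t.2) ∈ s}

/-- The variable of `DiffPoly R m (Y ⊕ Fin n)` that belongs to a derivative. -/
def emb (Y : Type v) (t : Fin n × (Fin m → ℕ)) : (Y ⊕ Fin n) × (Fin m → ℕ) := (Sum.inr t.1, t.2)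

theorem emb_mem_varsIn {s : Set (Fin n × (Fin m → ℕ))} {t : Fin n × (Fin m → ℕ)} (h : t ∈ s) :
    emb Y t ∈ varsIn Y s := by
  rintro z ⟨⟩
  exact h

theorem varsIn_mono {s t : Set (Fin n × (Fin m → ℕ))} (h : s ⊆ t) : varsIn Y s ⊆ varsIn Y t :=
  fun _ hx z hz => h (hx z hz)

variable (R Y) in
/-- Differential polynomials in variables below `t`. -/
noncomputable abbrev lower (t : Fin n × (Fin m → ℕ)) : Subalgebra R (DiffPoly R m (Y ⊕ Fin n)) :=
  supported R (varsIn Y {u | rank u < rank t})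

variable (R Y) in
/-- Differential polynomials in variables up to `t`. -/
noncomputable abbrev upto (t : Fin n × (Fin m → ℕ)) : Subalgebra R (DiffPoly R m (Y ⊕ Fin n)) :=
  supported R (varsIn Y {u | rank u ≤ rank t})

/-- By injectivity of the rank, the only variable not strictly below t is t itself, so everything up
to t is a polynomial in that one variable over `lower`. -/
theorem exists_aeval_eq_of_mem_upto {t : Fin n × (Fin m → ℕ)} {p : DiffPoly R m (Y ⊕ Fin n)}
    (hp : p ∈ upto R Y t) : ∃ g : Polynomial (lower R Y t), Polynomial.aeval (X (emb Y t)) g = p := by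
  let Φ : Polynomial (lower R Y t) →ₐ[R] DiffPoly R m (Y ⊕ Fin n) :=
    (Polynomial.aeval (X (emb Y t))).restrictScalars R
  suffices h : upto R Y t ≤ Φ.range from h hp
  refine Algebra.adjoin_le ?_
  rintro _ ⟨x, hx, rfl⟩
  by_cases hxt : x = emb Y t
  · exact ⟨Polynomial.X, by simp [Φ, hxt]⟩
  · have hx' : (X x : DiffPoly R m (Y ⊕ Fin n)) ∈ lower R Y t := by
      refine Algebra.subset_adjoin ⟨x, fun z hz => ?_, rfl⟩
      refine lt_of_le_of_ne (show rank (z, x.2) ≤ rank t from hx z hz) fun h => hxt ?_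
      rw [← rank_injective h, emb, ← hz]
    exact ⟨Polynomial.C ⟨_, hx'⟩, by simp [Φ]⟩

theorem lower_le_upto {t : Fin n × (Fin m → ℕ)} : lower R Y t ≤ upto R Y t :=
  supported_mono (varsIn_mono fun u (hx : rank u < rank t) => hx.le)

theorem X_mem_upto (t : Fin n × (Fin m → ℕ)) : X (emb Y t) ∈ upto R Y t :=
  Algebra.subset_adjoin ⟨_, emb_mem_varsIn (le_refl (rank t)), rfl⟩

theorem aeval_mem_upto {t : Fin n × (Fin m → ℕ)} (g : Polynomial (lower R Y t)) :
    Polynomial.aeval (X (emb Y t)) g ∈ upto R Y t := by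
  rw [Polynomial.aeval_eq_sum_range]
  refine Subalgebra.sum_mem _ fun k _ => mul_mem ?_ (pow_mem ?_ _)
  · exact lower_le_upto (g.coeff k).2
  · exact X_mem_upto t

/-- Only finitely many variables occur, so take the one of highest rank; if there is none, only
parameters occur. This drives inductions on rank. -/
theorem exists_mem_upto {s : Set (Fin n × (Fin m → ℕ))} {p : DiffPoly R m (Y ⊕ Fin n)}
    (hp : p ∈ supported R (varsIn Y s)) :
    p ∈ supported R (varsIn Y (∅ : Set (Fin n × (Fin m → ℕ)))) ∨ ∃ t ∈ s, p ∈ upto R Y t := by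
  classical
  rw [mem_supported] at hp
  let T : Set (Fin n × (Fin m → ℕ)) := {t | emb Y t ∈ p.vars}
  have hT : T.Finite := by
    refine Set.Finite.preimage (Function.Injective.injOn ?_) p.vars.finite_toSet
    rintro ⟨z, α⟩ ⟨z', α'⟩ h
    simp only [emb, Prod.mk.injEq, Sum.inr.injEq] at h
    rw [h.1, h.2]
  rcases T.eq_empty_or_nonempty with h0 | hne
  · left
    rw [mem_supported]
    rintro ⟨y, α⟩ hx z rfl
    have : (z, α) ∈ T := hx
    rwa [h0] at this
  · right
    obtain ⟨t, ht, hmax⟩ := Set.exists_max_image T rank hT hne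
    refine ⟨t, hp ht t.1 rfl, mem_supported.2 ?_⟩
    rintro ⟨y, α⟩ hx z rfl
    exact hmax (z, α) hx

theorem upto_le_lower {t u : Fin n × (Fin m → ℕ)} (h : rank t < rank u) :
    upto R Y t ≤ lower R Y u :=
  supported_mono (varsIn_mono fun _ hx => lt_of_le_of_lt hx h)

theorem δ_mem_lower (j : Fin m) {t : Fin n × (Fin m → ℕ)} {p : DiffPoly R m (Y ⊕ Fin n)}
    (hp : p ∈ lower R Y t) : DeltaAlgebra.δ (R := R) j p ∈ lower R Y (shift j t) := by
  have hle : lower R Y t ≤ lower R Y (shift j t) :=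
    supported_mono (varsIn_mono fun _ hx => lt_trans hx (rank_lt_rank_shift j t))
  refine Algebra.adjoin_induction (p := fun p _ =>
    DeltaAlgebra.δ (R := R) j p ∈ lower R Y (shift j t)) ?_ ?_ ?_ ?_ hp
  · rintro _ ⟨x, hx, rfl⟩
    rw [δ_X]
    refine Algebra.subset_adjoin ⟨_, fun z hz => ?_, rfl⟩
    exact rank_shift_lt_rank_shift j (hx z hz)
  · intro r
    rw [Derivation.map_algebraMap]
    exact zero_mem _
  · intro p q _ _ hp hq
    rw [map_add]
    exact add_mem hp hq
  · intro p q hp' hq' hp hq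
    rw [Derivation.leibniz]
    exact add_mem (mul_mem (hle hp') hq) (mul_mem (hle hq') hp)

/-- By the Leibniz rule, the new variable of highest rank comes only from differentiating the
variable t, and its coefficient is the separant, the formal derivative of g. Derivatives of the
coefficients of g stay below it. -/
theorem exists_δ_aeval_eq (j : Fin m) {t : Fin n × (Fin m → ℕ)} (g : Polynomial (lower R Y t)) :
    ∃ r ∈ lower R Y (shift j t), DeltaAlgebra.δ (R := R) j (Polynomial.aeval (X (emb Y t)) g) =
      Polynomial.aeval (X (emb Y t)) g.derivative * X (emb Y (shift j t)) + r := by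
  have hX : (X (emb Y t) : DiffPoly R m (Y ⊕ Fin n)) ∈ lower R Y (shift j t) :=
    upto_le_lower (rank_lt_rank_shift j t) (X_mem_upto t)
  induction g using Polynomial.induction_on' with
  | add p q hp hq =>
    obtain ⟨r, hr, hp⟩ := hp
    obtain ⟨r', hr', hq⟩ := hq
    refine ⟨r + r', add_mem hr hr', ?_⟩
    simp only [map_add, hp, hq]
    ring
  | monomial k a =>
    refine ⟨X (emb Y t) ^ k * DeltaAlgebra.δ (R := R) j (a : DiffPoly R m (Y ⊕ Fin n)),
      mul_mem (pow_mem hX _) (δ_mem_lower j a.2), ?_⟩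
    have hs : shift j (emb Y t) = emb Y (shift j t) := rfl
    rw [Polynomial.derivative_monomial, Polynomial.aeval_monomial, Polynomial.aeval_monomial,
      Derivation.leibniz, Derivation.leibniz_pow, δ_X, hs]
    simp only [smul_eq_mul, nsmul_eq_mul, map_mul, map_natCast]
    rw [show algebraMap (lower R Y t) (DiffPoly R m (Y ⊕ Fin n)) a = (a : DiffPoly R m (Y ⊕ Fin n))
      from rfl]
    ring

/-- Every proper derivative of g is linear in its highest variable, always with the separant s of g
as coefficient: differentiating s·X + r gives s·δX plus terms of lower rank. -/
theorem exists_linear_mem {J : Ideal (DiffPoly R m (Y ⊕ Fin n))} (hJ : J.IsDifferential R m)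
    {t : Fin n × (Fin m → ℕ)} {g : Polynomial (lower R Y t)}
    (hg : Polynomial.aeval (X (emb Y t)) g ∈ J) (γ : Fin m → ℕ) (hγ : γ ≠ 0) :
    ∃ r ∈ lower R Y (t.1, t.2 + γ),
      Polynomial.aeval (X (emb Y t)) g.derivative ∈ lower R Y (t.1, t.2 + γ) ∧
      Polynomial.aeval (X (emb Y t)) g.derivative * X (emb Y (t.1, t.2 + γ)) + r ∈ J := by
  induction γ using Pi.nat_induction with
  | h0 => exact absurd rfl hγ
  | hs γ j ih =>
    -- The statement is void at γ = 0, so the induction really starts with the first derivative.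
    by_cases h0 : γ = 0
    · subst h0
      rw [zero_add]
      obtain ⟨r, hr, h⟩ := exists_δ_aeval_eq j g
      exact ⟨r, hr, upto_le_lower (rank_lt_rank_shift j t) (aeval_mem_upto _), h ▸ hJ j _ hg⟩
    · obtain ⟨r, hr, hs, hmem⟩ := ih h0
      rw [← add_assoc]
      set w : Fin n × (Fin m → ℕ) := (t.1, t.2 + γ) with hw
      set s : DiffPoly R m (Y ⊕ Fin n) := Polynomial.aeval (X (emb Y t)) g.derivative
      change ∃ r ∈ lower R Y (shift j w), s ∈ lower R Y (shift j w) ∧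
        s * X (emb Y (shift j w)) + r ∈ J
      have hle : upto R Y w ≤ lower R Y (shift j w) := upto_le_lower (rank_lt_rank_shift j w)
      refine ⟨X (emb Y w) * DeltaAlgebra.δ (R := R) j s + DeltaAlgebra.δ (R := R) j r,
        add_mem (mul_mem (hle (X_mem_upto w)) (δ_mem_lower j hs)) (δ_mem_lower j hr),
        hle (lower_le_upto hs), ?_⟩
      have h := hJ j _ hmem
      rw [map_add, Derivation.leibniz, δ_X] at h
      rwa [smul_eq_mul, smul_eq_mul, add_assoc] at h

end DiffPoly

/-! ### Leaders and the characteristic set. -/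

namespace DiffPoly

open MvPolynomial

variable {R : Type u} [CommRing R] {m n : ℕ} {Y : Type v}

/-- The variable `t` is algebraic modulo `P` over the variables below it. -/
def IsLeader (P : Ideal (DiffPoly R m (Y ⊕ Fin n))) (t : Fin n × (Fin m → ℕ)) : Prop :=
  ∃ g : Polynomial (lower R Y t), Polynomial.aeval (X (emb Y t)) g ∈ P ∧
    (g.leadingCoeff : DiffPoly R m (Y ⊕ Fin n)) ∉ P

theorem natCast_notMem [Algebra ℚ R] {σ : Type*} {P : Ideal (MvPolynomial σ R)} [hP : P.IsPrime]
    {d : ℕ} (hd : d ≠ 0) : (d : MvPolynomial σ R) ∉ P := by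
  intro h
  refine hP.ne_top (P.eq_top_of_isUnit_mem h ?_)
  have h1 : IsUnit ((d : ℚ)) := isUnit_iff_ne_zero.2 (by exact_mod_cast hd)
  simpa using (h1.map (algebraMap ℚ R)).map (C (σ := σ))

/-- Take f of least degree d among the witnesses. Polynomials of smaller degree vanishing modulo P
then have all coefficients in P. The separant has top coefficient d times that of f, outside P
because nonzero integers are units, so the separant itself is outside P. -/
theorem IsLeader.exists_minimal [Algebra ℚ R] {P : Ideal (DiffPoly R m (Y ⊕ Fin n))}
    [hP : P.IsPrime] {t : Fin n × (Fin m → ℕ)} (ht : IsLeader P t) :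
    ∃ f : Polynomial (lower R Y t), Polynomial.aeval (X (emb Y t)) f ∈ P ∧
      (f.leadingCoeff : DiffPoly R m (Y ⊕ Fin n)) ∉ P ∧
      Polynomial.aeval (X (emb Y t)) f.derivative ∉ P ∧
      ∀ g : Polynomial (lower R Y t), Polynomial.aeval (X (emb Y t)) g ∈ P →
        g.degree < f.degree → ∀ k, (g.coeff k : DiffPoly R m (Y ⊕ Fin n)) ∈ P := by
  classical
  let D : Set ℕ := {d | ∃ g : Polynomial (lower R Y t), Polynomial.aeval (X (emb Y t)) g ∈ P ∧
    (g.leadingCoeff : DiffPoly R m (Y ⊕ Fin n)) ∉ P ∧ g.natDegree = d}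
  have hD : ∃ d, d ∈ D := by
    obtain ⟨g, hg, hg'⟩ := ht
    exact ⟨_, g, hg, hg', rfl⟩
  obtain ⟨f, hf, hfc, hfd⟩ := Nat.find_spec hD
  have hmin : ∀ g : Polynomial (lower R Y t), Polynomial.aeval (X (emb Y t)) g ∈ P →
      g.natDegree < f.natDegree → (g.leadingCoeff : DiffPoly R m (Y ⊕ Fin n)) ∈ P := by
    intro g hg hlt
    by_contra hgc
    exact Nat.find_min hD (hfd ▸ hlt) ⟨g, hg, hgc, rfl⟩
  have hpos : f.natDegree ≠ 0 := by
    intro h0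
    refine hfc ?_
    rw [Polynomial.eq_C_of_natDegree_eq_zero h0, Polynomial.aeval_C] at hf
    rw [Polynomial.leadingCoeff, h0]
    exact hf
  have hcoeff : ∀ g : Polynomial (lower R Y t), Polynomial.aeval (X (emb Y t)) g ∈ P →
      g.natDegree < f.natDegree → ∀ k, (g.coeff k : DiffPoly R m (Y ⊕ Fin n)) ∈ P := by
    intro g hg hlt
    exact Polynomial.coeff_mem_of_leadingCoeff_mem (d := f.natDegree - 1)
      (fun g hg hd => hmin g hg (by omega)) g hg (by omega)
  -- If the separant were in P, its coefficient at `natDegree - 1` would be too; positivity of the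
  -- degree makes that index the right one.
  refine ⟨f, hf, hfc, fun h => ?_, fun g hg hlt => ?_⟩
  · have h1 := hcoeff _ h (Polynomial.natDegree_derivative_lt hpos) (f.natDegree - 1)
    rw [Polynomial.coeff_derivative, Nat.sub_add_cancel (Nat.one_le_iff_ne_zero.2 hpos)] at h1
    have h2 : (f.leadingCoeff : DiffPoly R m (Y ⊕ Fin n)) * (f.natDegree : ℕ) ∈ P := by
      convert h1 using 1
      rw [MulMemClass.coe_mul]
      congr 1
      have : ((f.natDegree - 1 : ℕ) : lower R Y t) + 1 = ((f.natDegree : ℕ) : lower R Y t) := by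
        rw [← Nat.cast_add_one, Nat.sub_add_cancel (Nat.one_le_iff_ne_zero.2 hpos)]
      rw [this]
      exact (map_natCast (lower R Y t).val _).symm
    exact (hP.mem_or_mem h2).elim hfc (natCast_notMem hpos)
  · by_cases hg0 : g = 0
    · simp [hg0]
    · exact hcoeff g hg (Polynomial.natDegree_lt_natDegree hg0 hlt)

variable [IsDomain R]

/-- Pseudo-division by `f`: reduces membership in `Q` to the remainder. -/
theorem aeval_mem_of_remainder {P Q : Ideal (DiffPoly R m (Y ⊕ Fin n))} [hQ : Q.IsPrime]
    {t : Fin n × (Fin m → ℕ)} {f g : Polynomial (lower R Y t)} (hf0 : f ≠ 0)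
    (hfP : Polynomial.aeval (X (emb Y t)) f ∈ P) (hfQ : Polynomial.aeval (X (emb Y t)) f ∈ Q)
    (hfc : (f.leadingCoeff : DiffPoly R m (Y ⊕ Fin n)) ∉ Q)
    (hrem : ∀ r : Polynomial (lower R Y t), r.degree < f.degree →
      Polynomial.aeval (X (emb Y t)) r ∈ P → ∀ k, (r.coeff k : DiffPoly R m (Y ⊕ Fin n)) ∈ Q)
    (hg : Polynomial.aeval (X (emb Y t)) g ∈ P) : Polynomial.aeval (X (emb Y t)) g ∈ Q := by
  obtain ⟨N, a, r, h, hr⟩ := Polynomial.exists_leadingCoeff_pow_mul_eq hf0 g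
  have h' := congrArg (Polynomial.aeval (X (emb Y t) : DiffPoly R m (Y ⊕ Fin n))) h
  rw [map_mul, map_add, map_mul, Polynomial.aeval_C, map_pow] at h'
  have hrP : Polynomial.aeval (X (emb Y t)) r ∈ P := by
    rw [← sub_eq_iff_eq_add'] at h'
    rw [← h']
    exact P.sub_mem (P.mul_mem_left _ hg) (P.mul_mem_left _ hfP)
  have hQr := Polynomial.aeval_mem_of_coeff_mem (X (emb Y t)) (hrem r hr hrP)
  have hmem := Q.add_mem (Q.mul_mem_left (Polynomial.aeval (X (emb Y t)) a) hfQ) hQr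
  rw [← h'] at hmem
  exact (hQ.mem_or_mem hmem).resolve_left fun h => hfc (hQ.mem_of_pow_mem _ h)

/-- A prime differential ideal that contains no nonzero differential polynomial in the parameters
is determined by a finite subset and an element outside of it. -/
theorem exists_characteristic_set [Algebra ℚ R] (P : Ideal (DiffPoly R m (Y ⊕ Fin n)))
    [hP : P.IsPrime] (hPd : P.IsDifferential R m)
    (h0 : ∀ p ∈ P, p ∈ supported R (varsIn Y (∅ : Set (Fin n × (Fin m → ℕ)))) → p = 0) :
    ∃ (A : Set (DiffPoly R m (Y ⊕ Fin n))) (H : DiffPoly R m (Y ⊕ Fin n)),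
      A.Finite ∧ A ⊆ P ∧ H ∉ P ∧ ∀ Q : Ideal (DiffPoly R m (Y ⊕ Fin n)), Q.IsPrime →
        Q.IsDifferential R m → A ⊆ Q → H ∉ Q → P ≤ Q := by
  classical
  -- For each unknown z, finitely many minimal leaders suffice: every other leader is a proper
  -- derivative of one of them.
  choose M hMfin hML hM using fun z : Fin n =>
    Set.exists_finite_subset_forall_exists_le {α : Fin m → ℕ | IsLeader P (z, α)}
  choose f hfP hfc hfs hfmin using fun t : {t : Fin n × (Fin m → ℕ) // IsLeader P t} =>
    t.2.exists_minimal
  let T : Set {t : Fin n × (Fin m → ℕ) // IsLeader P t} := {t | t.1.2 ∈ M t.1.1}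
  have hT : T.Finite := by
    have h1 : (⋃ z, (fun α => (z, α)) '' M z).Finite :=
      Set.finite_iUnion fun z => (hMfin z).image _
    refine (h1.preimage Subtype.val_injective.injOn).subset fun t ht => ?_
    exact Set.mem_iUnion.2 ⟨t.1.1, t.1.2, ht, rfl⟩
  let A : Set (DiffPoly R m (Y ⊕ Fin n)) := (fun t => Polynomial.aeval (X (emb Y t.1)) (f t)) '' T
  -- H collects the initials and separants of the chosen polynomials. Primality keeps the product
  -- outside P, while H ∉ Q forces every factor outside Q.
  let H := ∏ t ∈ hT.toFinset, ((f t).leadingCoeff : DiffPoly R m (Y ⊕ Fin n)) *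
    Polynomial.aeval (X (emb Y t.1)) (f t).derivative
  refine ⟨A, H, hT.image _, ?_, ?_, fun Q hQ hQd hAQ hHQ => ?_⟩
  · rintro _ ⟨t, -, rfl⟩
    exact hfP t
  · intro h
    obtain ⟨t, -, ht⟩ := (hP.prod_mem_iff).1 h
    exact (hP.mem_or_mem ht).elim (hfc t) (hfs t)
  have hHt : ∀ t ∈ T, ((f t).leadingCoeff : DiffPoly R m (Y ⊕ Fin n)) ∉ Q ∧
      Polynomial.aeval (X (emb Y t.1)) (f t).derivative ∉ Q := by
    intro t ht
    rw [← not_or]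
    intro h
    refine hHQ (hQ.prod_mem_iff.2 ⟨t, hT.mem_toFinset.2 ht, ?_⟩)
    exact h.elim (fun h => Q.mul_mem_right _ h) fun h => Q.mul_mem_left _ h
  -- Induction on rank, with three cases: t is a minimal leader (reduce by its f), a proper
  -- derivative of one (reduce by a derivative of that f), or no leader (all coefficients lie in P
  -- already).
  have claim : ∀ t, ∀ p ∈ P, p ∈ upto R Y t → p ∈ Q := by
    intro t
    induction t using wellFounded_rank.induction with
    | _ t ih =>
      have ih' : ∀ p ∈ P, p ∈ lower R Y t → p ∈ Q := by
        intro p hp hpl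
        rcases exists_mem_upto hpl with h | ⟨u, hu, h⟩
        · rw [h0 p hp h]
          exact Q.zero_mem
        · exact ih u hu p hp h
      intro p hp hpt
      obtain ⟨g, rfl⟩ := exists_aeval_eq_of_mem_upto hpt
      by_cases ht : IsLeader P t
      · obtain ⟨α, hα, hle⟩ := hM t.1 t.2 ht
        have hα' : IsLeader P (t.1, α) := hML t.1 hα
        by_cases heq : α = t.2
        · subst heq
          have hQt := hHt ⟨t, ht⟩ hα
          refine aeval_mem_of_remainder (f := f ⟨t, ht⟩) ?_ (hfP ⟨t, ht⟩)
            (hAQ ⟨⟨t, ht⟩, hα, rfl⟩) hQt.1 (fun r hr hrP k => ?_) hp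
          · intro h
            have := hfc ⟨t, ht⟩
            rw [h] at this
            simp at this
          · exact ih' _ (hfmin ⟨t, ht⟩ r hrP hr k) (r.coeff k).2
        · obtain ⟨γ, hγ⟩ := exists_add_of_le hle
          have hγ0 : γ ≠ 0 := by
            rintro rfl
            exact heq (by rw [hγ, add_zero])
          -- Differentiating inside P ⊓ Q puts the same linear polynomial in both ideals. Its
          -- initial is the separant, which is outside Q.
          have hJ : (P ⊓ Q).IsDifferential R m := fun j p hp => ⟨hPd j p hp.1, hQd j p hp.2⟩
          have hQt := hHt ⟨(t.1, α), hα'⟩ hα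
          obtain ⟨r, hr, hs, hmem⟩ := exists_linear_mem hJ (t := (t.1, α))
            (g := f ⟨(t.1, α), hα'⟩) ⟨hfP ⟨_, hα'⟩, hAQ ⟨⟨_, hα'⟩, hα, rfl⟩⟩ γ hγ0
          have htt : ((t.1, α + γ) : Fin n × (Fin m → ℕ)) = t := by rw [← hγ]
          simp only [htt] at hr hs hmem
          set s : DiffPoly R m (Y ⊕ Fin n) := Polynomial.aeval (X (emb Y (t.1, α))) (f ⟨(t.1, α), hα'⟩).derivative
          have hs0 : (⟨s, hs⟩ : lower R Y t) ≠ 0 := by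
            intro h
            have hs0 : s = 0 := congrArg Subtype.val h
            exact hQt.2 (by rw [hs0]; exact Q.zero_mem)
          have hev : Polynomial.aeval (X (emb Y t)) (Polynomial.C (⟨s, hs⟩ : lower R Y t) *
              Polynomial.X + Polynomial.C ⟨r, hr⟩) = s * X (emb Y t) + r := by
            simp only [map_add, map_mul, Polynomial.aeval_C, Polynomial.aeval_X]
            rfl
          refine aeval_mem_of_remainder (f := Polynomial.C (⟨s, hs⟩ : lower R Y t) *
              Polynomial.X + Polynomial.C ⟨r, hr⟩) ?_ (hev ▸ hmem.1) (hev ▸ hmem.2) ?_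
              (fun r' hr' hrP k => ?_) hp
          · exact Polynomial.ne_zero_of_degree_gt
              (n := 0) (by rw [Polynomial.degree_linear hs0]; exact zero_lt_one)
          · rw [Polynomial.leadingCoeff_linear hs0]
            exact hQt.2
          · rw [Polynomial.degree_linear hs0] at hr'
            have hC := Polynomial.eq_C_of_degree_le_zero
              (Nat.WithBot.lt_one_iff_le_zero.1 hr')
            rw [hC, Polynomial.aeval_C] at hrP
            rw [hC, Polynomial.coeff_C]
            split_ifs
            · exact ih' _ hrP (r'.coeff 0).2
            · exact Q.zero_mem
      · refine Polynomial.aeval_mem_of_coeff_mem _ fun k => ih' _ ?_ (g.coeff k).2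
        refine Polynomial.coeff_mem_of_leadingCoeff_mem (fun g' hg' _ => ?_) g hp le_rfl k
        by_contra h
        exact ht ⟨g', hg', h⟩
  intro p hp
  have hpu : p ∈ supported R (varsIn Y (Set.univ : Set (Fin n × (Fin m → ℕ)))) :=
    mem_supported.2 fun _ _ _ _ => Set.mem_univ _
  rcases exists_mem_upto hpu with h | ⟨t, -, h⟩
  · rw [h0 p hp h]
    exact Q.zero_mem
  · exact claim t p hp h

end DiffPoly

/-! ### Differential homomorphisms and iterated derivatives. -/

/-- Homomorphisms of differential algebras. -/
def IsDeltaHom {R : Type u} [CommRing R] (m : ℕ) {B : Type v} {B' : Type w} [CommRing B]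
    [Algebra R B] [DeltaAlgebra R m B] [CommRing B'] [Algebra R B'] [DeltaAlgebra R m B']
    (φ : B →ₐ[R] B') : Prop :=
  ∀ (j : Fin m) (b : B), φ (DeltaAlgebra.δ (R := R) j b) = DeltaAlgebra.δ (R := R) j (φ b)

theorem IsDeltaHom.ker_isDifferential {R : Type u} [CommRing R] {m : ℕ} {B : Type v} {B' : Type w}
    [CommRing B] [Algebra R B] [DeltaAlgebra R m B] [CommRing B'] [Algebra R B']
    [DeltaAlgebra R m B'] {φ : B →ₐ[R] B'} (hφ : IsDeltaHom m φ) :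
    (RingHom.ker φ).IsDifferential R m := by
  intro j p hp
  rw [RingHom.mem_ker] at hp ⊢
  rw [hφ, hp, map_zero]

namespace DeltaAlgebra

variable (R : Type u) [CommRing R] (m : ℕ) (B : Type v) [CommRing B] [Algebra R B]
  [DeltaAlgebra R m B]

/-- The action of the monoid generated by the derivations. -/
noncomputable def partialHom : (Fin m → Multiplicative ℕ) →* Module.End R B :=
  MonoidHom.noncommPiCoprod
    (fun j => powersHom (Module.End R B) (DeltaAlgebra.δ (R := R) (A := B) j : B →ₗ[R] B))
    (fun i j _ x y => by
      rw [powersHom_apply, powersHom_apply]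
      refine Commute.pow_pow ?_ _ _
      exact LinearMap.ext fun a => DeltaAlgebra.δ_comm i j a)

variable {m B}

/-- The iterated derivative of order `α`. -/
noncomputable def partialDeriv (α : Fin m → ℕ) : Module.End R B :=
  partialHom R m B fun i => Multiplicative.ofAdd (α i)

theorem partialDeriv_zero (b : B) : partialDeriv R (0 : Fin m → ℕ) b = b := by
  have : partialDeriv R (0 : Fin m → ℕ) = (1 : Module.End R B) := map_one (partialHom R m B)
  rw [this, Module.End.one_apply]

theorem partialDeriv_add_single (α : Fin m → ℕ) (j : Fin m) (b : B) :
    partialDeriv R (α + Pi.single j 1) b = DeltaAlgebra.δ (R := R) j (partialDeriv R α b) := by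
  have h : (fun i => Multiplicative.ofAdd ((α + Pi.single j 1 : Fin m → ℕ) i) : Fin m → Multiplicative ℕ) =
      Pi.mulSingle j (Multiplicative.ofAdd 1) * fun i => Multiplicative.ofAdd (α i) := by
    funext i
    by_cases hi : i = j
    · subst hi
      simp [mul_comm]
    · simp [hi]
  have h1 : partialHom R m B (Pi.mulSingle j (Multiplicative.ofAdd 1)) =
      (DeltaAlgebra.δ (R := R) (A := B) j : B →ₗ[R] B) := by
    refine (MonoidHom.noncommPiCoprod_mulSingle _ _ _).trans ?_
    rw [powersHom_apply, toAdd_ofAdd, pow_one]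
  rw [partialDeriv, h, map_mul, h1]
  rfl

end DeltaAlgebra

/-! ### Substitution into differential polynomials. -/

namespace DiffPoly

open MvPolynomial DeltaAlgebra

variable {R : Type u} [CommRing R] {m : ℕ} {V : Type v} {B : Type w} [CommRing B] [Algebra R B]
  [DeltaAlgebra R m B]

/-- Substitution of elements of a differential algebra. -/
noncomputable def eval (b : V → B) : DiffPoly R m V →ₐ[R] B :=
  aeval fun t => partialDeriv R t.2 (b t.1)

theorem eval_X (b : V → B) (y : V) : eval b (X (y, 0) : DiffPoly R m V) = b y := by
  rw [eval, aeval_X, partialDeriv_zero]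

theorem eval_isDeltaHom (b : V → B) : IsDeltaHom m (eval b : DiffPoly R m V →ₐ[R] B) := by
  intro j p
  induction p using MvPolynomial.induction_on with
  | C r =>
    rw [← algebraMap_eq, Derivation.map_algebraMap, map_zero, AlgHom.commutes,
      Derivation.map_algebraMap]
  | add p q hp hq => rw [map_add, map_add, map_add, map_add, hp, hq]
  | mul_X p t hp =>
    rw [Derivation.leibniz, δ_X, map_mul, Derivation.leibniz, ← hp]
    simp only [smul_eq_mul, map_add, map_mul]
    congr 2
    rw [eval, aeval_X, aeval_X]
    exact partialDeriv_add_single R t.2 j _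

/-- Among the common zeroes in a family of points with values in a domain, every system of
differential equations in `n` unknowns is equivalent to a finite subsystem. -/
theorem exists_finset_forall_eval [IsDomain R] [Algebra ℚ R] [IsDomain B] {n : ℕ}
    {Y : Type v} {I : Type*} (φ : I → DiffPoly R m (Y ⊕ Fin n) →ₐ[R] B)
    (hφ : ∀ i, IsDeltaHom m (φ i))
    (hφ0 : ∀ i, ∀ p ∈ supported R (varsIn Y (∅ : Set (Fin n × (Fin m → ℕ)))), φ i p = 0 → p = 0)
    {J : Type*} (S : J → Set (DiffPoly R m (Y ⊕ Fin n))) :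
    ∃ T : Finset J, ∀ i, (∀ t ∈ T, ∀ p ∈ S t, φ i p = 0) → ∀ t, ∀ p ∈ S t, φ i p = 0 := by
  classical
  by_contra! hcon
  choose pt hpt t₀ p₀ hp₀ hne using hcon
  -- `pt F` satisfies the equations indexed by F but fails one indexed by `t₀ F`. P is the kernel of
  -- the ultraproduct of these points; it is prime because the values lie in a domain and U is an
  -- ultrafilter.
  let U : Ultrafilter (Finset J) := Ultrafilter.of Filter.atTop
  have hU : (U : Filter (Finset J)) ≤ Filter.atTop := Ultrafilter.of_le _
  let P : Ideal (DiffPoly R m (Y ⊕ Fin n)) :=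
    { carrier := {p | ∀ᶠ F in (U : Filter (Finset J)), φ (pt F) p = 0}
      add_mem' := fun {p q} hp hq => by
        filter_upwards [hp, hq] with F h1 h2
        rw [map_add, h1, h2, add_zero]
      zero_mem' := Filter.Eventually.of_forall fun F => map_zero _
      smul_mem' := fun c p hp => by
        filter_upwards [hp] with F h1
        rw [smul_eq_mul, map_mul, h1, mul_zero] }
  have memP : ∀ p, p ∈ P ↔ ∀ᶠ F in (U : Filter (Finset J)), φ (pt F) p = 0 := fun _ => Iff.rfl
  have hPp : P.IsPrime := by
    refine ⟨fun h => ?_, fun {p q} hpq => ?_⟩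
    · have h1 : (1 : DiffPoly R m (Y ⊕ Fin n)) ∈ P := h ▸ Submodule.mem_top
      obtain ⟨F, hF⟩ := ((memP _).1 h1).exists
      exact one_ne_zero ((map_one (φ (pt F))).symm.trans hF)
    · rw [memP, memP, ← Ultrafilter.eventually_or]
      filter_upwards [(memP _).1 hpq] with F hF
      rw [map_mul] at hF
      exact mul_eq_zero.1 hF
  have hPd : P.IsDifferential R m := by
    intro j p hp
    filter_upwards [(memP _).1 hp] with F hF
    rw [hφ, hF, map_zero]
  have hP0 : ∀ p ∈ P, p ∈ supported R (varsIn Y (∅ : Set (Fin n × (Fin m → ℕ)))) → p = 0 := by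
    intro p hp hp'
    obtain ⟨F, hF⟩ := ((memP _).1 hp).exists
    exact hφ0 _ p hp' hF
  obtain ⟨A, H, hAfin, hAP, hHP, hA⟩ := exists_characteristic_set P hPd hP0
  have hev1 : ∀ᶠ F in (U : Filter (Finset J)), ∀ a ∈ A, φ (pt F) a = 0 :=
    (Filter.eventually_all_finite hAfin).2 fun a ha => (memP a).1 (hAP ha)
  have hev2 : ∀ᶠ F in (U : Filter (Finset J)), φ (pt F) H ≠ 0 :=
    Ultrafilter.eventually_not.2 fun h => hHP ((memP H).2 h)
  obtain ⟨F, hF1, hF2⟩ := (hev1.and hev2).exists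
  refine hne F ?_
  -- The equation failing at `pt F` lies in P: every finite set containing `t₀ F` yields a point
  -- where it holds, and such sets are eventual along U.
  refine hA (RingHom.ker (φ (pt F))) (RingHom.ker_isPrime _) (hφ _).ker_isDifferential hF1 hF2 ?_
  filter_upwards [hU (Filter.eventually_ge_atTop {t₀ F})] with F' hF'
  exact hpt F' (t₀ F) (hF' (Finset.mem_singleton_self _)) _ (hp₀ F)

/-- A differential polynomial over an infinite domain that vanishes on `R[x₁, …, x_m]` is zero. -/
theorem eq_zero_of_forall_eval_eq_zero [IsDomain R] [Algebra ℚ R] (p : DiffPoly R m V)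
    (h : ∀ c : V → MvPolynomial (Fin m) R, eval c p = 0) : p = 0 := by
  classical
  -- A derivative of order α shifts coefficients by α and multiplies them by nonzero integers, which
  -- are invertible in R.
  have hcoeff : ∀ α : Fin m → ℕ, ∀ γ : Fin m →₀ ℕ, ∃ N : ℕ, N ≠ 0 ∧
      ∀ f : MvPolynomial (Fin m) R, coeff γ (partialDeriv R α f) =
        N * coeff (γ + Finsupp.equivFunOnFinite.symm α) f := by
    intro α
    induction α using Pi.nat_induction with
    | h0 =>
      refine fun γ => ⟨1, one_ne_zero, fun f => ?_⟩
      rw [partialDeriv_zero, Nat.cast_one, one_mul]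
      congr 1
      ext i
      simp
    | hs α j ih =>
      intro γ
      obtain ⟨N, hN, hf⟩ := ih (γ + Finsupp.single j 1)
      refine ⟨(γ j + 1) * N, mul_ne_zero (Nat.succ_ne_zero _) hN, fun f => ?_⟩
      rw [partialDeriv_add_single]
      change coeff γ (pderiv j _) = _
      rw [coeff_pderiv, hf]
      have he : γ + Finsupp.single j 1 + Finsupp.equivFunOnFinite.symm α =
          γ + Finsupp.equivFunOnFinite.symm (α + Pi.single j 1) := by
        ext i
        simp [Finsupp.single_apply, Pi.single_apply, eq_comm, add_assoc, add_comm]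
      rw [he]
      push_cast
      ring
  have hchar : ∀ N : ℕ, N ≠ 0 → IsUnit (N : R) := fun N hN => by
    simpa using (isUnit_iff_ne_zero.2 (Nat.cast_ne_zero.2 hN : (N : ℚ) ≠ 0)).map (algebraMap ℚ R)
  have : CharZero R := algebraRat.charZero R
  refine MvPolynomial.funext fun r => ?_
  choose N hN hNf using fun α => hcoeff α 0
  -- Prescribed Taylor coefficients at the origin: the derivative of order α of c y takes the value
  -- r (y, α) there for every variable occurring in p. Hence p at r is the constant term of `eval c
  -- p`, which is 0.
  let c : V → MvPolynomial (Fin m) R := fun y => ∑ α ∈ p.vars.image Prod.snd,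
    monomial (Finsupp.equivFunOnFinite.symm α) (r (y, α) * ↑(hchar (N α) (hN α)).unit⁻¹)
  have hc : ∀ t ∈ p.vars, constantCoeff (partialDeriv R t.2 (c t.1)) = r t := by
    rintro ⟨y, α⟩ ht
    rw [constantCoeff_eq, hNf, zero_add]
    simp only [c, coeff_sum, coeff_monomial, EmbeddingLike.apply_eq_iff_eq]
    rw [Finset.sum_ite_eq', if_pos (Finset.mem_image_of_mem Prod.snd ht), mul_left_comm]
    simp
  have h1 := congrArg constantCoeff (h c)
  rw [map_zero, eval] at h1
  rw [map_zero, ← h1]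
  have h2 : (constantCoeff (R := R) (σ := Fin m)).comp (aeval fun t : V × (Fin m → ℕ) =>
      partialDeriv R t.2 (c t.1)).toRingHom = eval₂Hom (RingHom.id R)
      fun t => constantCoeff (partialDeriv R t.2 (c t.1)) := by
    refine MvPolynomial.ringHom_ext (fun a => ?_) fun t => ?_
    · simp
    · simp
  have h3 := congrArg (fun f => f p) h2
  simp only [RingHom.comp_apply, AlgHom.toRingHom_eq_coe, RingHom.coe_coe] at h3
  rw [h3]
  exact eval₂Hom_congr' rfl (fun t ht _ => (hc t ht).symm) rfl

end DiffPoly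

/-! ### A common generalization of the algebras `L(B)` and `W(B)` -/

/-- The space of `L(B)` with the multiplication `f ∘ g - s (g ∘ f)`. -/
def DeformedWitt {R : Type u} (_s : R) (m : ℕ) (B : Type v) : Type v := LeftSymmetricWitt R m B

namespace DeformedWitt

variable {R : Type u} [CommRing R] {m : ℕ} {s : R} {B : Type v} [CommRing B] [Algebra R B]
  [DeltaAlgebra R m B] {B' : Type w} [CommRing B'] [Algebra R B'] [DeltaAlgebra R m B']

/-- The identification with the space of `L(B)`. -/
def toWitt (f : DeformedWitt s m B) : LeftSymmetricWitt R m B := f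

variable (s) in
/-- The element with given components. -/
def ofFun (f : Fin m → B) : DeformedWitt s m B := f

theorem toWitt_ofFun_apply (f : Fin m → B) (j : Fin m) : toWitt (ofFun s f) j = f j := rfl

instance : AddCommGroup (DeformedWitt s m B) :=
  inferInstanceAs (AddCommGroup (LeftSymmetricWitt R m B))

instance : Module R (DeformedWitt s m B) := inferInstanceAs (Module R (LeftSymmetricWitt R m B))

instance : Mul (DeformedWitt s m B) where
  mul f g := (toWitt f * toWitt g - s • (toWitt g * toWitt f) : LeftSymmetricWitt R m B)

theorem toWitt_injective : Function.Injective (toWitt : DeformedWitt s m B → _) := fun _ _ h => h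

theorem toWitt_mul (f g : DeformedWitt s m B) :
    toWitt (f * g) = toWitt f * toWitt g - s • (toWitt g * toWitt f) := rfl

theorem toWitt_add (f g : DeformedWitt s m B) : toWitt (f + g) = toWitt f + toWitt g := rfl

theorem toWitt_smul (r : R) (f : DeformedWitt s m B) : toWitt (r • f) = r • toWitt f := rfl

theorem toWitt_zero : toWitt (0 : DeformedWitt s m B) = 0 := rfl

instance : NonUnitalNonAssocRing (DeformedWitt s m B) where
  left_distrib f g h := toWitt_injective <| by
    simp only [toWitt_mul, toWitt_add, mul_add, add_mul, smul_add]
    abel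
  right_distrib f g h := toWitt_injective <| by
    simp only [toWitt_mul, toWitt_add, mul_add, add_mul, smul_add]
    abel
  zero_mul f := toWitt_injective <| by
    simp only [toWitt_mul, toWitt_zero, zero_mul, mul_zero, smul_zero, sub_zero]
  mul_zero f := toWitt_injective <| by
    simp only [toWitt_mul, toWitt_zero, zero_mul, mul_zero, smul_zero, sub_zero]

instance : IsScalarTower R (DeformedWitt s m B) (DeformedWitt s m B) where
  smul_assoc r f g := toWitt_injective <| by
    simp only [smul_eq_mul, toWitt_mul, toWitt_smul, smul_mul_assoc, mul_smul_comm, smul_sub]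
    rw [smul_comm]

instance : SMulCommClass R (DeformedWitt s m B) (DeformedWitt s m B) where
  smul_comm r f g := toWitt_injective <| by
    simp only [smul_eq_mul, toWitt_mul, toWitt_smul, smul_mul_assoc, mul_smul_comm, smul_sub]
    rw [smul_comm]

variable (s) in
/-- Functoriality in the differential algebra. -/
def map (φ : B →ₐ[R] B') (hφ : IsDeltaHom m φ) : DeformedWitt s m B →ₙₐ[R] DeformedWitt s m B' where
  toFun f := ofFun s fun j => φ (toWitt f j)
  map_smul' r f := by
    funext j
    exact map_smul φ r (toWitt f j)
  map_zero' := by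
    funext j
    exact map_zero φ
  map_add' f g := by
    funext j
    exact map_add φ (toWitt f j) (toWitt g j)
  map_mul' f g := by
    have key : ∀ (f g : DeformedWitt s m B) (j : Fin m), φ ((toWitt f * toWitt g) j) =
        (toWitt (ofFun s fun j => φ (toWitt f j)) * toWitt (ofFun s fun j => φ (toWitt g j))) j := by
      intro f g j
      simp only [LeftSymmetricWitt.mul_apply, toWitt_ofFun_apply, map_sum, map_mul, hφ _ _]
    refine toWitt_injective (funext fun j => ?_)
    rw [toWitt_ofFun_apply, toWitt_mul, toWitt_mul, LeftSymmetricWitt.sub_apply,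
      LeftSymmetricWitt.sub_apply, LeftSymmetricWitt.smul_apply, LeftSymmetricWitt.smul_apply,
      map_sub, map_smul, key, key]

theorem toWitt_map_apply (φ : B →ₐ[R] B') (hφ : IsDeltaHom m φ) (f : DeformedWitt s m B)
    (j : Fin m) : toWitt (map s φ hφ f) j = φ (toWitt f j) := rfl

variable (R m s) in
/-- The generic elements of `L(R{V × {1, …, m}})`. -/
noncomputable def generic (V : Type v) (y : V) : DeformedWitt s m (DiffPoly R m (V × Fin m)) :=
  ofFun s fun j => MvPolynomial.X ((y, j), 0)

/-- The substitution of the elements `b` for the generic elements. -/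
noncomputable def specialize {V : Type w} (b : V → DeformedWitt s m B) :
    DeformedWitt s m (DiffPoly R m (V × Fin m)) →ₙₐ[R] DeformedWitt s m B :=
  map s (DiffPoly.eval fun t => toWitt (b t.1) t.2) (DiffPoly.eval_isDeltaHom _)

theorem specialize_generic {V : Type w} (b : V → DeformedWitt s m B) (y : V) :
    specialize b (generic R m s V y) = b y :=
  toWitt_injective <| funext fun j => by
    rw [specialize, toWitt_map_apply, generic, toWitt_ofFun_apply, DiffPoly.eval_X]

theorem specialize_lift {V : Type w} (b : V → DeformedWitt s m B)
    (f : FreeNonUnitalNonAssocAlgebra R V) :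
    specialize b (FreeNonUnitalNonAssocAlgebra.lift R (generic R m s V) f) =
      FreeNonUnitalNonAssocAlgebra.lift R b f := by
  rw [← NonUnitalAlgHom.comp_apply]
  refine DFunLike.congr_fun (FreeNonUnitalNonAssocAlgebra.hom_ext R fun y => ?_) f
  rw [NonUnitalAlgHom.comp_apply, FreeNonUnitalNonAssocAlgebra.lift_of_apply,
    FreeNonUnitalNonAssocAlgebra.lift_of_apply, specialize_generic]

/-- The components of the generic value are differential polynomials vanishing at all points of C_m,
hence zero. -/
theorem lift_generic_eq_zero [IsDomain R] [Algebra ℚ R] {V : Type w}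
    {f : FreeNonUnitalNonAssocAlgebra R V}
    (hf : ∀ c : V → DeformedWitt s m (MvPolynomial (Fin m) R),
      FreeNonUnitalNonAssocAlgebra.lift R c f = 0) :
    FreeNonUnitalNonAssocAlgebra.lift R (generic R m s V) f = 0 := by
  refine toWitt_injective (funext fun j => ?_)
  refine DiffPoly.eq_zero_of_forall_eval_eq_zero _ fun c => ?_
  have h := hf fun y => ofFun s fun j => c (y, j)
  rw [← specialize_lift] at h
  exact congrFun (congrArg toWitt h) j

/-- The variety generated by the algebra over `C_m` contains the algebras over all differential
algebras. -/
theorem inVariety [IsDomain R] [Algebra ℚ R] :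
    InVariety R (identitiesOf R (DeformedWitt s m (MvPolynomial (Fin m) R)))
      (DeformedWitt s m B) := by
  intro f hf b
  rw [← specialize_lift, lift_generic_eq_zero hf, map_zero]

end DeformedWitt

/-! ### Free algebras -/

/-- Lifting the generators into N and including back is the identity on generators, hence
everywhere. -/
theorem FreeNonUnitalNonAssocAlgebra.eq_top_of_of_mem {R : Type u} [CommRing R] {X : Type v}
    (N : NonUnitalSubalgebra R (FreeNonUnitalNonAssocAlgebra R X))
    (h : ∀ x, FreeNonUnitalNonAssocAlgebra.of R x ∈ N) (g : FreeNonUnitalNonAssocAlgebra R X) :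
    g ∈ N := by
  have heq : (NonUnitalSubalgebraClass.subtype N).comp
      (FreeNonUnitalNonAssocAlgebra.lift R fun x => (⟨_, h x⟩ : N)) = NonUnitalAlgHom.id R _ := by
    refine FreeNonUnitalNonAssocAlgebra.hom_ext R fun x => ?_
    rw [NonUnitalAlgHom.comp_apply, FreeNonUnitalNonAssocAlgebra.lift_of_apply]
    rfl
  rw [show g = NonUnitalSubalgebraClass.subtype N
    (FreeNonUnitalNonAssocAlgebra.lift R (fun x => (⟨_, h x⟩ : N)) g) from
      (DFunLike.congr_fun heq g).symm]
  exact SetLike.coe_mem _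

/-- Every element of a free algebra involves only finitely many generators. -/
theorem FreeNonUnitalNonAssocAlgebra.exists_finite_support {R : Type u} [CommRing R] {X : Type v}
    (g : FreeNonUnitalNonAssocAlgebra R X) :
    ∃ S : Finset X, ∀ φ ψ : FreeNonUnitalNonAssocAlgebra R X →ₙₐ[R] FreeNonUnitalNonAssocAlgebra R X,
      (∀ x ∈ S, φ (of R x) = ψ (of R x)) → φ g = ψ g := by
  classical
  let N : NonUnitalSubalgebra R (FreeNonUnitalNonAssocAlgebra R X) :=
    { carrier := {g | ∃ S : Finset X, ∀ φ ψ :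
        FreeNonUnitalNonAssocAlgebra R X →ₙₐ[R] FreeNonUnitalNonAssocAlgebra R X,
        (∀ x ∈ S, φ (of R x) = ψ (of R x)) → φ g = ψ g}
      add_mem' := by
        rintro a b ⟨S, hS⟩ ⟨T, hT⟩
        refine ⟨S ∪ T, fun φ ψ h => ?_⟩
        rw [map_add, map_add, hS φ ψ fun x hx => h x (Finset.mem_union_left _ hx),
          hT φ ψ fun x hx => h x (Finset.mem_union_right _ hx)]
      zero_mem' := ⟨∅, fun φ ψ _ => by rw [map_zero, map_zero]⟩
      mul_mem' := by
        rintro a b ⟨S, hS⟩ ⟨T, hT⟩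
        refine ⟨S ∪ T, fun φ ψ h => ?_⟩
        rw [map_mul, map_mul, hS φ ψ fun x hx => h x (Finset.mem_union_left _ hx),
          hT φ ψ fun x hx => h x (Finset.mem_union_right _ hx)]
      smul_mem' := by
        rintro r a ⟨S, hS⟩
        exact ⟨S, fun φ ψ h => by rw [map_smul, map_smul, hS φ ψ h]⟩ }
  exact eq_top_of_of_mem N (fun x => ⟨{x}, fun φ ψ h => h x (Finset.mem_singleton_self x)⟩) g

theorem InVariety.of_injective {R : Type u} [CommRing R]
    {E : Set (FreeNonUnitalNonAssocAlgebra R ℕ)} {A : Type v} [NonUnitalNonAssocRing A] [Module R A]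
    [IsScalarTower R A A] [SMulCommClass R A A] {B : Type w} [NonUnitalNonAssocRing B] [Module R B]
    [IsScalarTower R B B] [SMulCommClass R B B] (hB : InVariety R E B) (φ : A →ₙₐ[R] B)
    (hφ : Function.Injective φ) : InVariety R E A := by
  intro f hf a
  have heq : φ.comp (FreeNonUnitalNonAssocAlgebra.lift R a) =
      FreeNonUnitalNonAssocAlgebra.lift R (φ ∘ a) := by
    refine FreeNonUnitalNonAssocAlgebra.hom_ext R fun x => ?_
    rw [NonUnitalAlgHom.comp_apply, FreeNonUnitalNonAssocAlgebra.lift_of_apply,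
      FreeNonUnitalNonAssocAlgebra.lift_of_apply, Function.comp_apply]
  refine hφ ?_
  rw [map_zero, ← NonUnitalAlgHom.comp_apply, heq]
  exact hB f hf _

theorem identitiesOf_eq_of_bijective {R : Type u} [CommRing R] {A : Type v}
    [NonUnitalNonAssocRing A] [Module R A] [IsScalarTower R A A] [SMulCommClass R A A]
    {B : Type w} [NonUnitalNonAssocRing B] [Module R B]
    [IsScalarTower R B B] [SMulCommClass R B B] (φ : A →ₙₐ[R] B) (hφ : Function.Bijective φ) :
    identitiesOf R A = identitiesOf R B := by
  refine Set.Subset.antisymm (fun f hf b => ?_) fun f hf => ?_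
  · choose a ha using fun i => hφ.2 (b i)
    have heq : φ.comp (FreeNonUnitalNonAssocAlgebra.lift R a) =
        FreeNonUnitalNonAssocAlgebra.lift R b := by
      refine FreeNonUnitalNonAssocAlgebra.hom_ext R fun x => ?_
      rw [NonUnitalAlgHom.comp_apply, FreeNonUnitalNonAssocAlgebra.lift_of_apply,
        FreeNonUnitalNonAssocAlgebra.lift_of_apply, ha]
    rw [← heq, NonUnitalAlgHom.comp_apply, hf a, map_zero]
  · exact InVariety.of_injective (fun f hf => hf : InVariety R (identitiesOf R B) B) φ hφ.1 f hf

namespace IsFreeInVariety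

variable {R : Type u} [CommRing R] {E : Set (FreeNonUnitalNonAssocAlgebra R ℕ)} {X : Type w}
  {F : Type v} [NonUnitalNonAssocRing F] [Module R F] [IsScalarTower R F F] [SMulCommClass R F F]
  {ι : X → F}

/-- The subalgebra generated by the free generators is again in the variety, so the universal
property maps F into it; by uniqueness, following this with the inclusion is the identity of F. -/
theorem lift_surjective (h : IsFreeInVariety R E ι) :
    Function.Surjective (FreeNonUnitalNonAssocAlgebra.lift R ι) := by
  set π := FreeNonUnitalNonAssocAlgebra.lift R ι
  let N := NonUnitalAlgHom.range π
  let i : N →ₙₐ[R] F := NonUnitalSubalgebraClass.subtype N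
  have hi : Function.Injective i := Subtype.val_injective
  have hmem : ∀ x, ι x ∈ N := fun x =>
    ⟨FreeNonUnitalNonAssocAlgebra.of R x, FreeNonUnitalNonAssocAlgebra.lift_of_apply R ι x⟩
  obtain ⟨φ, hφ, -⟩ := h.existsUnique_hom N (h.mem.of_injective i hi) fun x => ⟨ι x, hmem x⟩
  have heq : i.comp φ = NonUnitalAlgHom.id R F := by
    refine (h.existsUnique_hom F h.mem ι).unique (fun x => ?_) fun x => rfl
    rw [NonUnitalAlgHom.comp_apply, hφ]
    rfl
  intro a
  rw [show a = i (φ a) from (DFunLike.congr_fun heq a).symm]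
  exact (φ a).2

/-- An identity of the variety in the variables `X` vanishes on the free generators. -/
theorem lift_eq_zero {A : Type*} [NonUnitalNonAssocRing A] [Module R A] [IsScalarTower R A A]
    [SMulCommClass R A A] (h : IsFreeInVariety R (identitiesOf R A) ι)
    (g : FreeNonUnitalNonAssocAlgebra R X)
    (hg : ∀ a : X → A, FreeNonUnitalNonAssocAlgebra.lift R a g = 0) :
    FreeNonUnitalNonAssocAlgebra.lift R ι g = 0 := by
  classical
  obtain ⟨S, hS⟩ := FreeNonUnitalNonAssocAlgebra.exists_finite_support g
  -- Without generators the identity and zero maps agree, so g = 0; otherwise the inverse renaming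
  -- from ℕ to X can be defined.
  rcases isEmpty_or_nonempty X with hX | hX
  · have h1 := hS (NonUnitalAlgHom.id R _) 0 fun x => isEmptyElim x
    rw [show g = 0 from h1, map_zero]
  -- Identities use variables indexed by ℕ, while X may be uncountable: τ renames the finitely many
  -- generators in g, and σ undoes it.
  obtain ⟨τ, hτ⟩ : ∃ τ : X → ℕ, Set.InjOn τ S := by
    exact (Set.countable_iff_exists_injOn.1 S.countable_toSet)
  let σ : ℕ → X := Function.invFunOn τ S
  have hσ : ∀ x ∈ S, σ (τ x) = x := fun x hx => hτ.leftInvOn_invFunOn hx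
  let f : FreeNonUnitalNonAssocAlgebra R ℕ :=
    FreeNonUnitalNonAssocAlgebra.lift R (fun x => FreeNonUnitalNonAssocAlgebra.of R (τ x)) g
  have hfg : FreeNonUnitalNonAssocAlgebra.lift R
      (fun k => FreeNonUnitalNonAssocAlgebra.of R (σ k)) f = g := by
    refine hS ((FreeNonUnitalNonAssocAlgebra.lift R
      (fun k => FreeNonUnitalNonAssocAlgebra.of R (σ k))).comp (FreeNonUnitalNonAssocAlgebra.lift R
        (fun x => FreeNonUnitalNonAssocAlgebra.of R (τ x)))) (NonUnitalAlgHom.id R _) fun x hx => ?_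
    rw [NonUnitalAlgHom.comp_apply, FreeNonUnitalNonAssocAlgebra.lift_of_apply,
      FreeNonUnitalNonAssocAlgebra.lift_of_apply, hσ x hx]
    rfl
  have hf : f ∈ identitiesOf R A := by
    intro a
    have heq : (FreeNonUnitalNonAssocAlgebra.lift R a).comp (FreeNonUnitalNonAssocAlgebra.lift R
        fun x => FreeNonUnitalNonAssocAlgebra.of R (τ x)) =
        FreeNonUnitalNonAssocAlgebra.lift R (a ∘ τ) := by
      refine FreeNonUnitalNonAssocAlgebra.hom_ext R fun x => ?_
      simp only [NonUnitalAlgHom.comp_apply, FreeNonUnitalNonAssocAlgebra.lift_of_apply,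
        Function.comp_apply]
    exact (DFunLike.congr_fun heq g).trans (hg _)
  have heq : (FreeNonUnitalNonAssocAlgebra.lift R ι).comp (FreeNonUnitalNonAssocAlgebra.lift R
      fun k => FreeNonUnitalNonAssocAlgebra.of R (σ k)) =
      FreeNonUnitalNonAssocAlgebra.lift R (ι ∘ σ) := by
    refine FreeNonUnitalNonAssocAlgebra.hom_ext R fun x => ?_
    simp only [NonUnitalAlgHom.comp_apply, FreeNonUnitalNonAssocAlgebra.lift_of_apply,
      Function.comp_apply]
  rw [← hfg]
  exact (DFunLike.congr_fun heq f).trans (h.mem f hf _)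

end IsFreeInVariety

/-! ### Equations over free algebras as differential systems. -/

namespace DiffPoly

open MvPolynomial DeltaAlgebra

variable {R : Type u} [CommRing R] {m : ℕ} {V : Type v} {B : Type w} [CommRing B] [Algebra R B]
  [DeltaAlgebra R m B]

theorem partialDeriv_X (y : V) (α : Fin m → ℕ) :
    partialDeriv R α (X (y, 0) : DiffPoly R m V) = X (y, α) := by
  induction α using Pi.nat_induction with
  | h0 => exact partialDeriv_zero R _
  | hs α j ih => rw [partialDeriv_add_single, ih, δ_X, shift]

theorem map_partialDeriv {B' : Type*} [CommRing B'] [Algebra R B'] [DeltaAlgebra R m B']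
    {φ : B →ₐ[R] B'} (hφ : IsDeltaHom m φ) (α : Fin m → ℕ) (b : B) :
    φ (partialDeriv R α b) = partialDeriv R α (φ b) := by
  induction α using Pi.nat_induction with
  | h0 => rw [partialDeriv_zero, partialDeriv_zero]
  | hs α j ih => rw [partialDeriv_add_single, partialDeriv_add_single, hφ, ih]

theorem eq_of_isDeltaHom {φ ψ : DiffPoly R m V →ₐ[R] B} (hφ : IsDeltaHom m φ)
    (hψ : IsDeltaHom m ψ) (h : ∀ y, φ (X (y, 0)) = ψ (X (y, 0))) : φ = ψ := by
  refine MvPolynomial.algHom_ext fun t => ?_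
  rw [show t = (t.1, t.2) from rfl, ← partialDeriv_X, map_partialDeriv hφ, map_partialDeriv hψ, h]

end DiffPoly

open MvPolynomial in
/-- Subalgebras of the algebras over rings of differential polynomials are equationally
Noetherian. -/
theorem DeformedWitt.equationallyNoetherian_of_injective {R : Type u} [CommRing R] [IsDomain R]
    [Algebra ℚ R] {m : ℕ} {s : R} {Y : Type v} {F : Type w} [NonUnitalNonAssocRing F] [Module R F]
    [IsScalarTower R F F] [SMulCommClass R F F] (Φ : F →ₙₐ[R] DeformedWitt s m (DiffPoly R m Y))
    (hΦ : Function.Injective Φ) : EquationallyNoetherian R F := by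
  intro E hF n
  -- One differential unknown for each of the m components of each of the n variables; Y holds the
  -- parameters of the constants.
  let D := DiffPoly R m (Y ⊕ Fin (n * m))
  let e : Fin n × Fin m ≃ Fin (n * m) := finProdFinEquiv
  let incl : DiffPoly R m Y →ₐ[R] D := DiffPoly.eval fun y => X (Sum.inl y, 0)
  have hincl : IsDeltaHom m incl := DiffPoly.eval_isDeltaHom _
  let Θ : PreCoproduct R F n →ₙₐ[R] DeformedWitt s m D := FreeNonUnitalNonAssocAlgebra.lift R
    (Sum.elim (fun a => map s incl hincl (Φ a)) fun i => ofFun s fun j => X (Sum.inr (e (i, j)), 0))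
  let φ (a : Fin n → F) : D →ₐ[R] DiffPoly R m Y := DiffPoly.eval (Sum.elim (fun y => X (y, 0))
    fun k => toWitt (Φ (a (e.symm k).1)) (e.symm k).2)
  have hφ : ∀ a, IsDeltaHom m (φ a) := fun a => DiffPoly.eval_isDeltaHom _
  -- Every point is a retraction onto the coefficient ring, which gives the injectivity on
  -- parameters demanded by `DiffPoly.exists_finset_forall_eval`.
  have hφincl : ∀ a p, φ a (incl p) = p := by
    intro a p
    have : (φ a).comp incl = AlgHom.id R _ := by
      refine DiffPoly.eq_of_isDeltaHom (fun j b => ?_) (fun j b => rfl) fun y => ?_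
      · rw [AlgHom.comp_apply, AlgHom.comp_apply, hincl, hφ]
      · rw [AlgHom.comp_apply, DiffPoly.eval_X, DiffPoly.eval_X]
        rfl
    exact DFunLike.congr_fun this p
  have hφ0 : ∀ a, ∀ p ∈ supported R (DiffPoly.varsIn Y (∅ : Set (Fin (n * m) × (Fin m → ℕ)))),
      φ a p = 0 → p = 0 := by
    intro a p hp h
    suffices hle : supported R (DiffPoly.varsIn Y (∅ : Set (Fin (n * m) × (Fin m → ℕ)))) ≤
        incl.range by
      obtain ⟨q, rfl⟩ := hle hp
      have hq : q = 0 := (hφincl a q).symm.trans h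
      exact hq ▸ map_zero incl
    refine Algebra.adjoin_le ?_
    rintro _ ⟨⟨y | z, α⟩, hx, rfl⟩
    · refine ⟨X (y, α), ?_⟩
      change incl (X (y, α)) = _
      rw [← DiffPoly.partialDeriv_X, DiffPoly.map_partialDeriv hincl, DiffPoly.eval_X,
        DiffPoly.partialDeriv_X]
    · exact (hx z rfl).elim
  have hΘ : ∀ (a : Fin n → F) (p : PreCoproduct R F n),
      Φ (evalAt hF a (Coproduct.mk R E F n p)) = map s (φ a) (hφ a) (Θ p) := by
    intro a p
    have heq : Φ.comp (FreeNonUnitalNonAssocAlgebra.lift R (Sum.elim (NonUnitalAlgHom.id R F) a)) =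
        (map s (φ a) (hφ a)).comp Θ := by
      refine FreeNonUnitalNonAssocAlgebra.hom_ext R fun x => ?_
      rw [NonUnitalAlgHom.comp_apply, NonUnitalAlgHom.comp_apply,
        FreeNonUnitalNonAssocAlgebra.lift_of_apply, FreeNonUnitalNonAssocAlgebra.lift_of_apply]
      refine toWitt_injective (funext fun j => ?_)
      rw [toWitt_map_apply]
      cases x with
      | inl b =>
        rw [Sum.elim_inl, Sum.elim_inl, toWitt_map_apply, hφincl]
        rfl
      | inr i =>
        rw [Sum.elim_inr, Sum.elim_inr, toWitt_ofFun_apply, DiffPoly.eval_X, Sum.elim_inr,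
          Equiv.symm_apply_apply]
    exact DFunLike.congr_fun heq p
  have hzero : ∀ (a : Fin n → F) (p : PreCoproduct R F n),
      evalAt hF a (Coproduct.mk R E F n p) = 0 ↔ ∀ j, φ a (toWitt (Θ p) j) = 0 := by
    intro a p
    rw [← map_eq_zero_iff Φ hΦ, hΘ]
    exact ⟨fun h j => congrFun (congrArg toWitt h) j, fun h => toWitt_injective (funext h)⟩
  let τ : TopologicalSpace (Fin n → F) := zariskiTopology hF n
  refine TopologicalSpace.noetherianSpace_iff_isCompact.2 fun K => ?_
  -- By Alexander's subbase theorem, only covers by complements of zero sets matter. A point avoids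
  -- such a set exactly when it solves the corresponding system, so an equivalent finite subsystem
  -- yields a finite subcover.
  refine isCompact_generateFrom rfl fun P hP hK => ?_
  choose S hS using fun U : P => hP U.2
  obtain ⟨T, hT⟩ := DiffPoly.exists_finset_forall_eval φ hφ hφ0 fun U : P =>
    {q | ∃ p j, Coproduct.mk R E F n p ∈ S U ∧ q = toWitt (Θ p) j}
  refine ⟨Subtype.val '' (T : Set P), ?_, T.finite_toSet.image _, fun a ha => ?_⟩
  · rintro _ ⟨U, -, rfl⟩
    exact U.2
  · by_contra hcon
    obtain ⟨U, hU, haU⟩ := hK ha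
    have hvan := hT a (fun V hV q hq => by
      obtain ⟨p, j, hp, rfl⟩ := hq
      have haV : a ∉ V.1 := fun h => hcon ⟨V.1, ⟨V, hV, rfl⟩, h⟩
      rw [hS V, Set.notMem_compl_iff] at haV
      exact (hzero a p).1 (haV _ hp) j) ⟨U, hU⟩
    have hUS := hS ⟨U, hU⟩
    change U = _ at hUS
    rw [hUS] at haU
    refine haU fun f hf => ?_
    obtain ⟨p, rfl⟩ := Coproduct.mk_surjective R E F n f
    exact (hzero a p).2 fun j => hvan _ ⟨p, j, hf, rfl⟩

/-- The free algebras of the variety generated by the algebra over `C_m` are equationally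
Noetherian. -/
theorem DeformedWitt.equationallyNoetherian_of_isFreeInVariety {R : Type u} [CommRing R]
    [IsDomain R] [Algebra ℚ R] {m : ℕ} {s : R} {X : Type w} {F : Type (max u v w)}
    [NonUnitalNonAssocRing F] [Module R F] [IsScalarTower R F F] [SMulCommClass R F F] {ι : X → F}
    (h : IsFreeInVariety R (identitiesOf R (DeformedWitt s m (MvPolynomial (Fin m) R))) ι) :
    EquationallyNoetherian R F := by
  -- The lift puts the target of Φ in the universe of F, as the universal property requires.
  let X' : Type (max v w) := ULift.{v} X
  obtain ⟨Φ, hΦ, -⟩ := h.existsUnique_hom (DeformedWitt s m (DiffPoly R m (X' × Fin m)))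
    inVariety fun x => generic R m s X' ⟨x⟩
  -- If Φ kills the image of g, specializing the generic elements shows that g vanishes on the
  -- algebra over C_m, so it is an identity and its image in F is 0.
  refine equationallyNoetherian_of_injective Φ ((injective_iff_map_eq_zero Φ).2 fun a ha => ?_)
  obtain ⟨g, rfl⟩ := h.lift_surjective a
  refine h.lift_eq_zero g fun c => ?_
  have heq : (specialize fun x : X' => c x.down).comp
      (Φ.comp (FreeNonUnitalNonAssocAlgebra.lift R ι)) = FreeNonUnitalNonAssocAlgebra.lift R c := by
    refine FreeNonUnitalNonAssocAlgebra.hom_ext R fun x => ?_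
    rw [NonUnitalAlgHom.comp_apply, NonUnitalAlgHom.comp_apply,
      FreeNonUnitalNonAssocAlgebra.lift_of_apply, FreeNonUnitalNonAssocAlgebra.lift_of_apply, hΦ,
      specialize_generic]
  rw [← heq, NonUnitalAlgHom.comp_apply, NonUnitalAlgHom.comp_apply, ha, map_zero]

theorem DeformedWitt.identitiesOf_zero (R : Type u) [CommRing R] (m : ℕ) :
    identitiesOf R (DeformedWitt (0 : R) m (MvPolynomial (Fin m) R)) = identitiesOf R (WittL R m) :=
  identitiesOf_eq_of_bijective
    { toFun := toWitt
      map_smul' := toWitt_smul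
      map_zero' := toWitt_zero
      map_add' := toWitt_add
      map_mul' := fun f g => by rw [toWitt_mul, zero_smul, sub_zero] } Function.bijective_id

theorem DeformedWitt.identitiesOf_one (R : Type u) [CommRing R] (m : ℕ) :
    identitiesOf R (DeformedWitt (1 : R) m (MvPolynomial (Fin m) R)) = identitiesOf R (WittW R m) :=
  identitiesOf_eq_of_bijective
    { toFun := fun f => (toWitt f : WittL R m)
      map_smul' := toWitt_smul
      map_zero' := toWitt_zero
      map_add' := toWitt_add
      map_mul' := fun f g => by
        rw [toWitt_mul, one_smul]
        rfl } Function.bijective_id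

theorem corollary7 {R : Type u} [CommRing R] [IsDomain R] [Algebra ℚ R]
    (hR : RadicallyNoetherian R) (m : ℕ) :
    (∀ (X : Type w) (F : Type (max u v w)) [NonUnitalNonAssocRing F] [Module R F]
      [IsScalarTower R F F] [SMulCommClass R F F] (ι : X → F),
      IsFreeInVariety R (identitiesOf R (WittL R m)) ι → EquationallyNoetherian R F) ∧
    (∀ (X : Type w) (F : Type (max u v w)) [NonUnitalNonAssocRing F] [Module R F]
      [IsScalarTower R F F] [SMulCommClass R F F] (ι : X → F),
      IsFreeInVariety R (identitiesOf R (WittW R m)) ι → EquationallyNoetherian R F) := by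
  refine ⟨fun X F _ _ _ _ ι h => ?_, fun X F _ _ _ _ ι h => ?_⟩
  · rw [← DeformedWitt.identitiesOf_zero] at h
    exact DeformedWitt.equationallyNoetherian_of_isFreeInVariety.{u, v, w} h
  · rw [← DeformedWitt.identitiesOf_one] at h
    exact DeformedWitt.equationallyNoetherian_of_isFreeInVariety.{u, v, w} h
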